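/- For a real number $x>0$, let $S(x)$ be a square of side $x$ in the plane. A packing of $S(x)$ by unit squares is a collection of unit squares, in arbitrary position (translated and rotated), all contained in $S(x)$ and with pairwise disjoint interiors. Let $W(x)$ denote the least area of the part of $S(x)$ left uncovered by such a packing, the minimum being taken over all packings. Then $$W(x) = O(x^{3/5}) \qquad (x \to \infty),$$ that is, there are constants $C$ and $x_0$ such that $W(x) \le C x^{3/5}$ for all real $x \ge x_0$. -/

import Mathlib

/-- The closed unit square in the plane with one corner at `p`, one side in direction
`(cos θ, sin θ)` and the other in direction `(-sin θ, cos θ)`. -/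
def unitSquare (p : ℝ × ℝ) (θ : ℝ) : Set (ℝ × ℝ) :=
  (fun q : ℝ × ℝ => (p.1 + q.1 * Real.cos θ - q.2 * Real.sin θ,
    p.2 + q.1 * Real.sin θ + q.2 * Real.cos θ)) '' (Set.Icc 0 1 ×ˢ Set.Icc 0 1)

/-- The square of side `x`. -/
def bigSquare (x : ℝ) : Set (ℝ × ℝ) :=
  Set.Icc 0 x ×ˢ Set.Icc 0 x

/-- `P` is a packing of the square of side `x` by unit squares: the members of `P` are unit
squares in arbitrary position, contained in the big square, with pairwise disjoint interiors. -/
structure IsUnitSquarePacking (x : ℝ) (P : Set (Set (ℝ × ℝ))) : Prop where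
  isUnitSquare : ∀ Q ∈ P, ∃ (p : ℝ × ℝ) (θ : ℝ), Q = unitSquare p θ
  subset : ∀ Q ∈ P, Q ⊆ bigSquare x
  disjoint_interiors : P.PairwiseDisjoint interior

/-- The areas (Lebesgue measures) of the parts of the square of side `x` that are left uncovered
by the packings of this square by unit squares. -/
noncomputable def uncoveredAreas (x : ℝ) : Set ℝ :=
  {A | ∃ P : Set (Set (ℝ × ℝ)), IsUnitSquarePacking x P ∧
    A = MeasureTheory.volume.real (bigSquare x \ ⋃₀ P)}

/-- `W(x)`: the least area left uncovered by a packing of the square of side `x` by unit squares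
(see `isLeast_wastedArea`: the infimum is a minimum). -/
noncomputable def wastedArea (x : ℝ) : ℝ :=
  sInf (uncoveredAreas x)

theorem volume_unitSquare (p : ℝ × ℝ) (θ : ℝ) :
    MeasureTheory.volume (unitSquare p θ) = 1 ∧ Convex ℝ (unitSquare p θ) := by
  set L : (ℝ × ℝ) →ₗ[ℝ] (ℝ × ℝ) := Matrix.toLin (Module.Basis.finTwoProd ℝ)
    (Module.Basis.finTwoProd ℝ) !![Real.cos θ, -Real.sin θ; Real.sin θ, Real.cos θ] with hL
  have hdet : LinearMap.det L = 1 := by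
    rw [hL, LinearMap.det_toLin, Matrix.det_fin_two_of]
    nlinarith [Real.sin_sq_add_cos_sq θ]
  have hU : unitSquare p θ =
      (fun q => p + q) '' (L '' (Set.Icc (0 : ℝ) 1 ×ˢ Set.Icc (0 : ℝ) 1)) := by
    rw [unitSquare, Set.image_image]
    refine Set.image_congr fun q _ => ?_
    rw [hL, Matrix.toLin_finTwoProd_apply]
    ext <;> simp <;> ring
  constructor
  · rw [hU, Set.image_add_left, MeasureTheory.measure_preimage_add,
      MeasureTheory.Measure.addHaar_image_linearMap, hdet,
      MeasureTheory.Measure.volume_eq_prod, MeasureTheory.Measure.prod_prod]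
    simp
  · rw [hU, Set.image_add_left]
    exact (((convex_Icc _ _).prod (convex_Icc _ _)).linear_image L).translate_preimage_right (-p)

/-- The uncovered area is `x ^ 2` minus the number of squares, so its infimum is a minimum. -/
theorem isLeast_wastedArea (x : ℝ) : IsLeast (uncoveredAreas x) (wastedArea x) := by
  have hne : (uncoveredAreas x).Nonempty :=
    ⟨_, ∅, ⟨by simp, by simp, by simp⟩, rfl⟩
  have hS : MeasureTheory.volume (bigSquare x) ≠ ⊤ :=
    (isCompact_Icc.prod isCompact_Icc).measure_lt_top.ne
  have hsub : uncoveredAreas x ⊆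
      (fun n : ℕ => MeasureTheory.volume.real (bigSquare x) - n) ''
        Set.Iic ⌊MeasureTheory.volume.real (bigSquare x)⌋₊ := by
    rintro A ⟨P, hP, rfl⟩
    have h1 : ∀ Q ∈ P, MeasureTheory.volume Q = 1 ∧ Convex ℝ Q := by
      intro Q hQ
      obtain ⟨p, θ, rfl⟩ := hP.isUnitSquare Q hQ
      exact volume_unitSquare p θ
    have hfr : ∀ Q ∈ P, interior Q =ᵐ[MeasureTheory.volume] Q := fun Q hQ =>
      interior_ae_eq_of_null_frontier ((h1 Q hQ).2.addHaar_frontier _)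
    have hint : ∀ Q ∈ P, (interior Q).Nonempty := by
      intro Q hQ
      by_contra h
      have h0 := MeasureTheory.measure_congr (hfr Q hQ)
      rw [Set.not_nonempty_iff_eq_empty.mp h, (h1 Q hQ).1] at h0
      simp at h0
    have hc : P.Countable :=
      hP.disjoint_interiors.countable_of_isOpen (fun Q _ => isOpen_interior) hint
    have hnm : ∀ Q ∈ P, MeasureTheory.NullMeasurableSet Q MeasureTheory.volume := fun Q hQ =>
      isOpen_interior.measurableSet.nullMeasurableSet.congr (hfr Q hQ)
    have hsum : MeasureTheory.volume (⋃₀ P) = (P.encard : ENNReal) := by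
      rw [Set.sUnion_eq_biUnion, MeasureTheory.measure_biUnion₀ hc _ hnm]
      · rw [tsum_congr fun Q : P => (h1 Q Q.2).1, ENNReal.tsum_set_one]
      · intro Q hQ R hR hQR
        exact (hP.disjoint_interiors hQ hR hQR).aedisjoint.congr
          (hfr Q hQ).symm (hfr R hR).symm
    have hPS : ⋃₀ P ⊆ bigSquare x := Set.sUnion_subset hP.subset
    have hUm : MeasureTheory.NullMeasurableSet (⋃₀ P) MeasureTheory.volume := by
      rw [Set.sUnion_eq_biUnion]
      exact MeasureTheory.NullMeasurableSet.biUnion hc hnm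
    have hle := MeasureTheory.measure_mono (μ := MeasureTheory.volume) hPS
    have hfin : P.Finite := by
      by_contra h
      rw [Set.not_finite.mp h |>.encard_eq] at hsum
      rw [hsum] at hle
      exact hS (top_le_iff.mp (by simpa using hle))
    have hr : MeasureTheory.volume.real (⋃₀ P) = P.ncard := by
      rw [MeasureTheory.measureReal_def, hsum, ← hfin.cast_ncard_eq]
      simp
    refine ⟨P.ncard, Nat.le_floor ?_, ?_⟩
    · rw [← hr]
      exact MeasureTheory.measureReal_mono hPS hS
    · beta_reduce
      rw [← hr, MeasureTheory.measureReal_def, MeasureTheory.measureReal_def,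
        MeasureTheory.measureReal_def, MeasureTheory.measure_sdiff hPS hUm
          (ne_top_of_le_ne_top hS hle), ENNReal.toReal_sub_of_le hle hS]
  have hfin : (uncoveredAreas x).Finite := ((Set.finite_Iic _).image _).subset hsub
  exact ⟨hne.csInf_mem hfin, fun A hA => csInf_le hfin.bddBelow hA⟩

/-! Write `x = z ^ 5`, `q = ⌈z⌉₊`, and cut the square into an axis-parallel square of integer side
and two strips whose width `h`, at most `28 q⁴`, is congruent to `x` modulo `1`. The integer square
wastes nothing, so it is enough to pack each strip, of length at most `q⁵`, with waste `O(q³)`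
(`packs_strip`).

Leaning a bar of `N` squares by the tangent `t ≈ 1/q²` lowers it by about `N t²/2`, so some `N` of
order `q⁴` makes the bars fit `h` up to `O(q⁻²)`. Over a length `q⁵` they waste `O(q³)`. At each end
of the strip a trapezoid with one side of slope `t` remains, and `packs_wedge` packs it, again with
waste `O(q³)`.

A trapezoid is cut into `O(q²)` layers of height about `2q²`, across which its slanted side moves by
`2`. A row of about `2q²` squares with tangent `1/q` is one unit shorter horizontally than its
length; this makes up for the non-integer width. A layer is a pair of teeth. In stage `r` of a
tooth, `q` tilted rows are laid and the part above them is narrowed by `2q` columns. The next rows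
are shorter, so tilting saves `1/q` less, and the slanted side has meanwhile receded by about `1/q`.
The extra thickness of tilted rows is matched by a slightly steeper line between the two teeth. Each
layer wastes only `O(q)` (`packs_pair`, `packs_stacked_teeth`). -/

/-! ### Counting packings: gluing along lines and moving by isometries. -/

/-- The region `R` contains at least `t` unit squares with pairwise disjoint interiors. -/
def Packs (R : Set (ℝ × ℝ)) (t : ℝ) : Prop :=
  ∃ P : Finset (Set (ℝ × ℝ)), (∀ Q ∈ P, ∃ (p : ℝ × ℝ) (θ : ℝ), Q = unitSquare p θ) ∧
    (∀ Q ∈ P, Q ⊆ R) ∧ (P : Set (Set (ℝ × ℝ))).PairwiseDisjoint interior ∧ t ≤ P.card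

theorem Packs.mono {R R' : Set (ℝ × ℝ)} {t t' : ℝ} (h : Packs R t) (hR : R ⊆ R') (ht : t' ≤ t) :
    Packs R' t' := by
  obtain ⟨P, h1, h2, h3, h4⟩ := h
  exact ⟨P, h1, fun Q hQ => (h2 Q hQ).trans hR, h3, ht.trans h4⟩

theorem Packs.of_nonpos (R : Set (ℝ × ℝ)) {t : ℝ} (ht : t ≤ 0) : Packs R t :=
  ⟨∅, by simp, by simp, by simp, by simpa using ht⟩

theorem interior_unitSquare_nonempty (p : ℝ × ℝ) (θ : ℝ) :
    (interior (unitSquare p θ)).Nonempty := by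
  by_contra h
  have h1 := volume_unitSquare p θ
  have h0 := MeasureTheory.measure_congr (μ := MeasureTheory.volume)
    (interior_ae_eq_of_null_frontier (h1.2.addHaar_frontier MeasureTheory.volume))
  rw [Set.not_nonempty_iff_eq_empty.mp h, h1.1] at h0
  simp at h0

theorem interior_line_eq_empty {α β c : ℝ} (h : α ≠ 0 ∨ β ≠ 0) :
    interior {z : ℝ × ℝ | α * z.1 + β * z.2 = c} = ∅ := by
  rw [Set.eq_empty_iff_forall_notMem]
  intro z hz
  have hc : Filter.Tendsto (fun ε : ℝ => (z.1 + ε * α, z.2 + ε * β))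
      (nhdsWithin 0 (Set.Ioi 0)) (nhds z) := by
    have : Continuous (fun ε : ℝ => (z.1 + ε * α, z.2 + ε * β)) := by fun_prop
    have h2 := this.tendsto 0
    simp only [zero_mul, add_zero] at h2
    exact h2.mono_left nhdsWithin_le_nhds
  have hz' := interior_subset hz
  have hev := hc.eventually (mem_interior_iff_mem_nhds.mp hz)
  obtain ⟨ε, hε, hε0⟩ := (hev.and self_mem_nhdsWithin).exists
  simp only [Set.mem_ofPred_eq] at hε hε0 hz'
  have h3 : ε * (α ^ 2 + β ^ 2) = 0 := by linarith
  have h4 : α ^ 2 + β ^ 2 = 0 := by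
    rcases mul_eq_zero.mp h3 with h | h
    · exact absurd h hε0.ne'
    · exact h
  rcases h with h | h
  · exact h (by nlinarith [sq_nonneg α, sq_nonneg β])
  · exact h (by nlinarith [sq_nonneg α, sq_nonneg β])

open Classical in
/-- Packings on the two sides of a line combine. -/
theorem Packs.split {R R₁ R₂ : Set (ℝ × ℝ)} {t₁ t₂ : ℝ} (α β c : ℝ) (hαβ : α ≠ 0 ∨ β ≠ 0)
    (h₁ : Packs R₁ t₁) (h₂ : Packs R₂ t₂) (s₁ : R₁ ⊆ R) (s₂ : R₂ ⊆ R)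
    (l₁ : ∀ z ∈ R₁, α * z.1 + β * z.2 ≤ c) (l₂ : ∀ z ∈ R₂, c ≤ α * z.1 + β * z.2) :
    Packs R (t₁ + t₂) := by
  obtain ⟨P, a1, a2, a3, a4⟩ := h₁
  obtain ⟨P', b1, b2, b3, b4⟩ := h₂
  have key : ∀ Q ∈ P, ∀ Q' ∈ P', Disjoint (interior Q) (interior Q') := by
    intro Q hQ Q' hQ'
    rw [Set.disjoint_iff_inter_eq_empty, ← interior_inter]
    apply Set.subset_eq_empty _ (interior_line_eq_empty (c := c) hαβ)
    apply interior_mono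
    intro z hz
    exact le_antisymm (l₁ z (a2 Q hQ hz.1)) (l₂ z (b2 Q' hQ' hz.2))
  -- A square in both families would have an interior disjoint from itself. Disjointness is needed
  -- to add the cardinalities.
  have hd : Disjoint P P' := by
    rw [Finset.disjoint_left]
    intro Q hQ hQ'
    obtain ⟨p, θ, rfl⟩ := a1 Q hQ
    have := key _ hQ _ hQ'
    rw [disjoint_self] at this
    exact (interior_unitSquare_nonempty p θ).ne_empty this
  refine ⟨P ∪ P', ?_, ?_, ?_, ?_⟩
  · intro Q hQ
    rcases Finset.mem_union.mp hQ with h | h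
    exacts [a1 Q h, b1 Q h]
  · intro Q hQ
    rcases Finset.mem_union.mp hQ with h | h
    exacts [(a2 Q h).trans s₁, (b2 Q h).trans s₂]
  · intro Q hQ Q' hQ' hne
    simp only [Finset.coe_union, Set.mem_union, Finset.mem_coe] at hQ hQ'
    rcases hQ with h | h <;> rcases hQ' with h' | h'
    · exact a3 h h' hne
    · exact key _ h _ h'
    · exact (key _ h' _ h).symm
    · exact b3 h h' hne
  · rw [Finset.card_union_of_disjoint hd]
    push_cast
    linarith

open Classical in
theorem Packs.image {R R' : Set (ℝ × ℝ)} {t : ℝ} (e : (ℝ × ℝ) ≃ₜ (ℝ × ℝ))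
    (he : ∀ p θ, ∃ p' θ', e '' unitSquare p θ = unitSquare p' θ')
    (h : Packs R t) (hR : ∀ z ∈ R, e z ∈ R') : Packs R' t := by
  obtain ⟨P, h1, h2, h3, h4⟩ := h
  have hinj : Function.Injective (fun Q : Set (ℝ × ℝ) => e '' Q) :=
    Set.image_injective.mpr e.injective
  refine ⟨P.image (fun Q => e '' Q), ?_, ?_, ?_, ?_⟩
  · intro Q hQ
    obtain ⟨Q', hQ', rfl⟩ := Finset.mem_image.mp hQ
    obtain ⟨p, θ, rfl⟩ := h1 Q' hQ'
    exact he p θ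
  · intro Q hQ
    obtain ⟨Q', hQ', rfl⟩ := Finset.mem_image.mp hQ
    rintro _ ⟨z, hz, rfl⟩
    exact hR z (h2 Q' hQ' hz)
  · intro Q hQ Q' hQ' hne
    obtain ⟨A, hA, rfl⟩ := Finset.mem_image.mp (Finset.mem_coe.mp hQ)
    obtain ⟨B, hB, rfl⟩ := Finset.mem_image.mp (Finset.mem_coe.mp hQ')
    have := h3 hA hB (fun h => hne (by rw [h]))
    simp only [Function.onFun, ← e.image_interior]
    exact (Set.disjoint_image_iff e.injective).mpr this
  · rwa [Finset.card_image_of_injective _ hinj]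

theorem Packs.translate {R R' : Set (ℝ × ℝ)} {t : ℝ} (v : ℝ × ℝ) (h : Packs R t)
    (hR : ∀ z ∈ R, (z.1 + v.1, z.2 + v.2) ∈ R') : Packs R' t := by
  refine h.image (Homeomorph.addRight v) (fun p θ => ⟨p + v, θ, ?_⟩) hR
  simp only [unitSquare, Set.image_image]
  refine Set.image_congr fun q _ => ?_
  ext <;> simp <;> ring

theorem Packs.pointReflect {R R' : Set (ℝ × ℝ)} {t : ℝ} (v : ℝ × ℝ) (h : Packs R t)
    (hR : ∀ z ∈ R, (v.1 - z.1, v.2 - z.2) ∈ R') : Packs R' t := by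
  refine h.image (Homeomorph.subLeft v) (fun p θ => ⟨v - p, θ + Real.pi, ?_⟩) hR
  simp only [unitSquare, Set.image_image]
  refine Set.image_congr fun q _ => ?_
  ext <;> simp <;> ring

theorem Packs.swap {R R' : Set (ℝ × ℝ)} {t : ℝ} (h : Packs R t)
    (hR : ∀ z ∈ R, (z.2, z.1) ∈ R') : Packs R' t := by
  -- The reflection reverses orientation, so the two sides of each unit square exchange their roles
  -- in the parametrisation.
  refine h.image (Homeomorph.prodComm ℝ ℝ) (fun p θ => ⟨p.swap, -θ, ?_⟩) hR
  simp only [unitSquare, Set.image_image]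
  ext z
  constructor
  · rintro ⟨q, hq, rfl⟩
    refine ⟨q.swap, ⟨hq.2, hq.1⟩, ?_⟩
    ext <;> simp <;> ring
  · rintro ⟨q, hq, rfl⟩
    refine ⟨q.swap, ⟨hq.2, hq.1⟩, ?_⟩
    ext <;> simp <;> ring

theorem exists_cos_sin_eq {c s : ℝ} (h : c ^ 2 + s ^ 2 = 1) :
    ∃ θ : ℝ, Real.cos θ = c ∧ Real.sin θ = s := by
  have hn : ‖(⟨c, s⟩ : ℂ)‖ = 1 := by
    rw [Complex.norm_eq_sqrt_sq_add_sq, h, Real.sqrt_one]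
  have h0 : (⟨c, s⟩ : ℂ) ≠ 0 := by
    intro h0
    rw [h0] at hn
    simp at hn
  refine ⟨Complex.arg ⟨c, s⟩, ?_, ?_⟩
  · rw [Complex.cos_arg h0, hn, div_one]
  · rw [Complex.sin_arg, hn, div_one]

/-! ### Bars, rectangles and columns. -/

/-- A bar of `n` unit squares in direction `(c, s)`. -/
theorem Packs.bar {R : Set (ℝ × ℝ)} {c s : ℝ} (hcs : c ^ 2 + s ^ 2 = 1) (ξ₀ η₀ : ℝ) (n : ℕ)
    (hR : ∀ ξ η : ℝ, ξ₀ ≤ ξ → ξ ≤ ξ₀ + n → η₀ ≤ η → η ≤ η₀ + 1 →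
      (c * ξ - s * η, s * ξ + c * η) ∈ R) : Packs R n := by
  have hne : c ≠ 0 ∨ s ≠ 0 := by
    by_contra! h
    rw [h.1, h.2] at hcs
    norm_num at hcs
  have hcs' : ∀ ξ η : ℝ, c * (c * ξ - s * η) + s * (s * ξ + c * η) = ξ := by
    intro ξ η
    linear_combination ξ * hcs
  induction n generalizing R with
  | zero => exact Packs.of_nonpos R (by simp)
  | succ n ih =>
    push_cast at hR ⊢
    refine Packs.split (R₁ := R ∩ {z | c * z.1 + s * z.2 ≤ ξ₀ + n})
      (R₂ := R ∩ {z | ξ₀ + n ≤ c * z.1 + s * z.2}) c s (ξ₀ + n) hne ?_ ?_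
      Set.inter_subset_left Set.inter_subset_left (fun z hz => hz.2) (fun z hz => hz.2)
    · apply ih
      intro ξ η h1 h2 h3 h4
      refine ⟨hR ξ η h1 (by linarith) h3 h4, ?_⟩
      simpa [hcs'] using h2
    · obtain ⟨θ, hc, hs⟩ := exists_cos_sin_eq hcs
      refine ⟨{unitSquare (c * (ξ₀ + n) - s * η₀, s * (ξ₀ + n) + c * η₀) θ}, ?_, ?_, ?_, ?_⟩
      · intro Q hQ
        exact ⟨_, _, Finset.mem_singleton.mp hQ⟩
      · intro Q hQ
        rw [Finset.mem_singleton.mp hQ]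
        rintro _ ⟨⟨a, b⟩, ⟨⟨ha, ha'⟩, ⟨hb, hb'⟩⟩, rfl⟩
        simp only at ha ha' hb hb'
        have hn : (0 : ℝ) ≤ n := n.cast_nonneg
        have := hR (ξ₀ + n + a) (η₀ + b) (by linarith) (by linarith) (by linarith) (by linarith)
        have e : (c * (ξ₀ + n + a) - s * (η₀ + b), s * (ξ₀ + n + a) + c * (η₀ + b)) =
            ((c * (ξ₀ + n) - s * η₀) + a * Real.cos θ - b * Real.sin θ,
              (s * (ξ₀ + n) + c * η₀) + a * Real.sin θ + b * Real.cos θ) := by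
          rw [hc, hs]
          ext <;> simp <;> ring
        have hv := hcs' (ξ₀ + n + a) (η₀ + b)
        simp only [Prod.mk.injEq] at e
        rw [e.1, e.2] at this hv
        refine ⟨this, ?_⟩
        simp only [Set.mem_ofPred_eq]
        linarith
      · simp
      · simp

/-- `K` adjacent parallel bars of `n` unit squares, each shifted freely along its direction. -/
theorem Packs.bars {R : Set (ℝ × ℝ)} {c s : ℝ} (hcs : c ^ 2 + s ^ 2 = 1) (η₀ : ℝ) (K n : ℕ)
    (o : ℝ → ℝ)
    (hR : ∀ k : ℕ, k < K → ∀ ξ η : ℝ, o k ≤ ξ → ξ ≤ o k + n → η₀ + k ≤ η → η ≤ η₀ + k + 1 →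
      (c * ξ - s * η, s * ξ + c * η) ∈ R) : Packs R (K * n) := by
  have hne : -s ≠ 0 ∨ c ≠ 0 := by
    by_contra! h
    rw [h.2, neg_eq_zero.mp h.1] at hcs
    norm_num at hcs
  have hcs' : ∀ ξ η : ℝ, -s * (c * ξ - s * η) + c * (s * ξ + c * η) = η := by
    intro ξ η
    linear_combination η * hcs
  induction K generalizing R with
  | zero => exact Packs.of_nonpos R (by simp)
  | succ K ih =>
    have : ((K + 1 : ℕ) : ℝ) * n = K * n + n := by push_cast; ring
    rw [this]
    refine Packs.split (R₁ := R ∩ {z | -s * z.1 + c * z.2 ≤ η₀ + K})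
      (R₂ := R ∩ {z | η₀ + K ≤ -s * z.1 + c * z.2}) (-s) c (η₀ + K) hne ?_ ?_
      Set.inter_subset_left Set.inter_subset_left (fun z hz => hz.2) (fun z hz => hz.2)
    · apply ih
      intro k hk ξ η h1 h2 h3 h4
      refine ⟨hR k (by omega) ξ η h1 h2 h3 h4, ?_⟩
      have : (k : ℝ) + 1 ≤ K := by exact_mod_cast hk
      simp only [Set.mem_ofPred_eq, hcs']
      linarith
    · apply Packs.bar hcs (o K) (η₀ + K) n
      intro ξ η h1 h2 h3 h4
      refine ⟨hR K (by omega) ξ η h1 h2 h3 h4, ?_⟩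
      simp only [Set.mem_ofPred_eq, hcs']
      exact h3

theorem Packs.rectangle {R : Set (ℝ × ℝ)} (x₀ y₀ : ℝ) (A B : ℕ)
    (hR : ∀ x y : ℝ, x₀ ≤ x → x ≤ x₀ + A → y₀ ≤ y → y ≤ y₀ + B → (x, y) ∈ R) :
    Packs R (A * B) := by
  have h := Packs.bars (R := R) (c := 1) (s := 0) (by norm_num) y₀ B A (fun _ => x₀) ?_
  · exact h.mono le_rfl (mul_comm _ _).le
  · intro k hk ξ η h1 h2 h3 h4
    have : (k : ℝ) + 1 ≤ B := by exact_mod_cast hk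
    have hk0 : (0 : ℝ) ≤ k := k.cast_nonneg
    have := hR ξ η h1 h2 (by linarith) (by linarith)
    simpa using this

/-- A rectangle of integer width `A` and arbitrary height. -/
theorem Packs.columns {R : Set (ℝ × ℝ)} (x₀ y₀ y₁ : ℝ) (A : ℕ)
    (hR : ∀ x y : ℝ, x₀ ≤ x → x ≤ x₀ + A → y₀ ≤ y → y ≤ y₁ → (x, y) ∈ R) :
    Packs R (A * (y₁ - y₀ - 1)) := by
  by_cases h : 0 ≤ y₁ - y₀
  · refine (Packs.rectangle (R := R) x₀ y₀ A ⌊y₁ - y₀⌋₊ ?_).mono le_rfl ?_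
    · intro x y h1 h2 h3 h4
      have := Nat.floor_le h
      exact hR x y h1 h2 h3 (by linarith)
    · have := Nat.lt_floor_add_one (y₁ - y₀)
      exact mul_le_mul_of_nonneg_left (by linarith) A.cast_nonneg
  · exact Packs.of_nonpos R (mul_nonpos_of_nonneg_of_nonpos A.cast_nonneg (by linarith))

/-! ### From counts to uncovered area. -/

theorem wastedArea_nonneg (x : ℝ) : 0 ≤ wastedArea x := by
  obtain ⟨P, -, h⟩ := (isLeast_wastedArea x).1
  rw [h]
  exact MeasureTheory.measureReal_nonneg

theorem wastedArea_le_of_packs {x t : ℝ} (hx : 0 ≤ x) (h : Packs (bigSquare x) t) :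
    wastedArea x ≤ x ^ 2 - t := by
  obtain ⟨P, h1, h2, h3, h4⟩ := h
  have hmem : MeasureTheory.volume.real (bigSquare x \ ⋃₀ (P : Set (Set (ℝ × ℝ)))) ∈
      uncoveredAreas x := ⟨P, ⟨h1, h2, h3⟩, rfl⟩
  refine ((isLeast_wastedArea x).2 hmem).trans ?_
  have hcl : ∀ Q ∈ P, MeasurableSet Q := by
    intro Q hQ
    obtain ⟨p, θ, rfl⟩ := h1 Q hQ
    refine IsCompact.measurableSet ((isCompact_Icc.prod isCompact_Icc).image ?_)
    fun_prop
  have hv : ∀ Q ∈ P, MeasureTheory.volume Q = 1 ∧ Convex ℝ Q := by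
    intro Q hQ
    obtain ⟨p, θ, rfl⟩ := h1 Q hQ
    exact volume_unitSquare p θ
  have hS : MeasureTheory.volume (bigSquare x) ≠ ⊤ :=
    (isCompact_Icc.prod isCompact_Icc).measure_lt_top.ne
  have hSr : MeasureTheory.volume.real (bigSquare x) = x ^ 2 := by
    rw [bigSquare, MeasureTheory.measureReal_def, MeasureTheory.Measure.volume_eq_prod,
      MeasureTheory.Measure.prod_prod, Real.volume_Icc, ENNReal.toReal_mul,
      ENNReal.toReal_ofReal (by linarith)]
    ring
  have hU : MeasureTheory.volume (⋃₀ (P : Set (Set (ℝ × ℝ)))) = P.card := by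
    rw [Set.sUnion_eq_biUnion]
    simp only [Finset.mem_coe]
    rw [MeasureTheory.measure_biUnion_finset₀ _ fun Q hQ => (hcl Q hQ).nullMeasurableSet]
    · rw [Finset.sum_congr rfl fun Q hQ => (hv Q hQ).1]
      simp
    · intro Q hQ Q' hQ' hne
      exact (h3 hQ hQ' hne).aedisjoint.congr
        (interior_ae_eq_of_null_frontier ((hv Q hQ).2.addHaar_frontier _)).symm
        (interior_ae_eq_of_null_frontier ((hv Q' hQ').2.addHaar_frontier _)).symm
  have hsub : ⋃₀ (P : Set (Set (ℝ × ℝ))) ⊆ bigSquare x := Set.sUnion_subset h2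
  have hUm : MeasurableSet (⋃₀ (P : Set (Set (ℝ × ℝ)))) :=
    MeasurableSet.sUnion P.countable_toSet hcl
  rw [MeasureTheory.measureReal_sdiff hsub hUm hS, hSr,
    MeasureTheory.measureReal_def, hU]
  simp only [ENNReal.toReal_natCast]
  linarith

/-! ### Teeth. -/

/-- A stack of tilted rows: between the slanted lines `y - τ x = b κ` and `y - τ x = (b + K) κ`,
to the right of `x = x₀`. -/
theorem packs_tilted_rows {R : Set (ℝ × ℝ)} {c s τ κ : ℝ} (hcs : c ^ 2 + s ^ 2 = 1) (hc : 0 < c)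
    (hs : 0 ≤ s) (hτ : s = τ * c) (hκ : κ * c = 1) (x₀ b : ℝ) (K n : ℕ)
    (hR : ∀ x y : ℝ, x₀ ≤ x → x ≤ x₀ + s + c * n → b * κ ≤ y - τ * x → y - τ * x ≤ (b + K) * κ →
      (x, y) ∈ R) : Packs R (K * n) := by
  have hκ0 : 0 < κ := pos_of_mul_pos_left (hκ ▸ one_pos) hc.le
  have hτ' : c + τ * s = κ := by
    have : c * (c + τ * s) = c * κ := by linear_combination hcs - hκ - s * hτ
    exact mul_left_cancel₀ hc.ne' this
  -- The offset puts the upper left corner of each row, its leftmost point, on the line `x = x₀`.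
  refine Packs.bars hcs b K n (fun k => (x₀ + s * (b + k + 1)) / c) ?_
  intro k hk ξ η h1 h2 h3 h4
  have hk' : (k : ℝ) + 1 ≤ K := by exact_mod_cast hk
  have hk0 : (0 : ℝ) ≤ k := k.cast_nonneg
  rw [div_le_iff₀ hc] at h1
  have h2' : c * ξ ≤ x₀ + s * (b + k + 1) + c * n := by
    have := mul_le_mul_of_nonneg_left h2 hc.le
    rwa [mul_add, mul_div_cancel₀ _ hc.ne'] at this
  have e : s * ξ + c * η - τ * (c * ξ - s * η) = η * κ := by
    linear_combination ξ * hτ + η * hτ'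
  have h5 := mul_le_mul_of_nonneg_left h4 hs
  have h6 := mul_le_mul_of_nonneg_left h3 hs
  apply hR
  · linarith
  · linarith
  · rw [e]
    exact mul_le_mul_of_nonneg_right (by linarith) hκ0.le
  · rw [e]
    exact mul_le_mul_of_nonneg_right (by linarith) hκ0.le

/-- The lower tooth, with `k` of its `q` stages still to be laid. Stage `r` lays `q` rows of slope
`τ` starting at abscissa `r * a`, then stands `a` upright columns of `k * q` squares on their left
part, `k` now counting the later stages; the remainder is the region of stage `r + 1`. `hV` says
that the columns stay below the top line of slope `τ'`, `hH` that the rows stay left of the receding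
right side. -/
theorem packs_toothA_aux {q a w : ℕ} {c s τ κ τ' M t : ℝ} (hcs : c ^ 2 + s ^ 2 = 1) (hc : 0 < c)
    (hs : 0 ≤ s) (hτ : s = τ * c) (hκ : κ * c = 1) (hττ' : τ ≤ τ') (ht : 0 ≤ t)
    (hw : q * a ≤ w)
    (hV : ∀ r : ℕ, r < q →
      (r + 1) * q * κ + τ + (q - 1 - r) * q ≤ M + (τ' - τ) * (r * a))
    (hH : ∀ r : ℕ, r < q → s + c * (w + 1 - r * a) ≤ w - r * a + t * (r * q)) :
    ∀ k r : ℕ, r + k = q → Packs {z | r * a ≤ z.1 ∧ r * q * κ ≤ z.2 - τ * z.1 ∧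
      z.2 - τ' * z.1 ≤ M ∧ z.1 ≤ w + t * z.2} (q * k * (w + 1 - r * a)) := by
  have hc1 : c ≤ 1 := by nlinarith [sq_nonneg s]
  have hκ1 : 1 ≤ κ := by nlinarith
  have hτ0 : 0 ≤ τ := by
    by_contra! h
    nlinarith [mul_pos_of_neg_of_neg h (neg_lt_zero.mpr hc)]
  intro k
  induction k with
  | zero => intro r hr; exact Packs.of_nonpos _ (by simp)
  | succ k ih =>
    intro r hr
    have hrq : r < q := by omega
    have hq : (q : ℝ) = r + 1 + k := by rw [← hr]; push_cast; ring
    have hra : (r + 1) * a ≤ w := (Nat.mul_le_mul_right a (by omega)).trans hw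
    obtain ⟨n, hn⟩ := Nat.exists_eq_add_of_le hra
    have hn' : (w : ℝ) = (r + 1) * a + n := by rw [hn]; push_cast; ring
    have hV := hV r hrq
    have hH := hH r hrq
    have ihr := ih (r + 1) (by omega)
    have ha0 : (0 : ℝ) ≤ a := a.cast_nonneg
    have hr0 : (0 : ℝ) ≤ r := r.cast_nonneg
    have hq0 : (0 : ℝ) ≤ q := q.cast_nonneg
    have hk0 : (0 : ℝ) ≤ k := k.cast_nonneg
    have hra0 : (0 : ℝ) ≤ r * a := mul_nonneg hr0 ha0
    have hrq0 : (0 : ℝ) ≤ r * q := mul_nonneg hr0 hq0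
    have hkq0 : (0 : ℝ) ≤ k * q := mul_nonneg hk0 hq0
    have hrqκ : (r : ℝ) * q ≤ r * q * κ := le_mul_of_one_le_right hrq0 hκ1
    have hqκ : (0 : ℝ) ≤ q * κ := by positivity
    have ek : ((q : ℝ) - 1 - r) * q = k * q := by rw [hq]; ring
    rw [ek] at hV
    have hδ : 0 ≤ τ' - τ := by linarith
    -- the tilted rows
    have p1 : Packs {z : ℝ × ℝ | r * a ≤ z.1 ∧ r * q * κ ≤ z.2 - τ * z.1 ∧
        z.2 - τ * z.1 ≤ (r + 1) * q * κ ∧ z.2 - τ' * z.1 ≤ M ∧ z.1 ≤ w + t * z.2}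
        (q * (n + a + 1 : ℕ)) := by
      refine packs_tilted_rows hcs hc hs hτ hκ (r * a) (r * q) q _ ?_
      intro x y h1 h2 h3 h4
      have e1 : (r * q + q : ℝ) * κ = (r + 1) * q * κ := by ring
      rw [e1] at h4
      have hx : 0 ≤ x := by linarith
      have h5 := mul_le_mul_of_nonneg_left h1 hδ
      have h6 : 0 ≤ τ * x := mul_nonneg hτ0 hx
      refine ⟨h1, h3, h4, by linarith, ?_⟩
      have e2 : ((n + a + 1 : ℕ) : ℝ) = w + 1 - r * a := by rw [hn']; push_cast; ring
      rw [e2] at h2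
      have : t * (r * q) ≤ t * y := mul_le_mul_of_nonneg_left (by linarith) ht
      show x ≤ w + t * y
      linarith
    -- the vertical columns
    have p2 : Packs {z : ℝ × ℝ | r * a ≤ z.1 ∧ z.1 ≤ (r + 1) * a ∧
        (r + 1) * q * κ ≤ z.2 - τ * z.1 ∧ z.2 - τ' * z.1 ≤ M ∧ z.1 ≤ w + t * z.2}
        (a * (k * q : ℕ)) := by
      -- Columns are numbered from right to left; each starts where its right edge meets the rising
      -- top of the rows.
      refine Packs.bars (c := 0) (s := 1) (by norm_num) (-((r + 1) * a)) a _
        (fun j => (r + 1) * q * κ + τ * ((r + 1) * a - j)) ?_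
      intro j hj ξ η h1 h2 h3 h4
      have hj' : (j : ℝ) + 1 ≤ a := by exact_mod_cast hj
      have hj0 : (0 : ℝ) ≤ j := j.cast_nonneg
      push_cast at h2
      have g1 : (r : ℝ) * a ≤ -η := by linarith
      have h5 := mul_le_mul_of_nonneg_left g1 hδ
      have h6 : τ * (-η) ≤ τ * ((r + 1) * a - j) := mul_le_mul_of_nonneg_left (by linarith) hτ0
      have h7 : τ * ((r + 1) * a - j) ≤ τ * (-η + 1) := mul_le_mul_of_nonneg_left (by linarith) hτ0
      have h8 : 0 ≤ τ * (-η) := mul_nonneg hτ0 (by linarith)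
      have h9 : (r + 1) * q * κ = r * q * κ + q * κ := by ring
      have h10 : 0 ≤ t * ξ := mul_nonneg ht (by linarith)
      have hn0 : (0 : ℝ) ≤ n := n.cast_nonneg
      simp only [Set.mem_ofPred_eq, zero_mul, one_mul, zero_sub, add_zero]
      refine ⟨g1, by linarith, by linarith, ?_, by linarith⟩
      linarith
    have p3 := Packs.split (R := {z : ℝ × ℝ | r * a ≤ z.1 ∧ (r + 1) * q * κ ≤ z.2 - τ * z.1 ∧
        z.2 - τ' * z.1 ≤ M ∧ z.1 ≤ w + t * z.2}) 1 0 ((r + 1) * a) (Or.inl one_ne_zero) p2 ihr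
      (fun z hz => ⟨hz.1, hz.2.2⟩)
      (fun z hz => ⟨by
          have := hz.1
          push_cast at this
          linarith, by simpa using hz.2⟩)
      (fun z hz => by linarith [hz.2.1])
      (fun z hz => by
          have := hz.1
          push_cast at this
          linarith)
    have h9 : (r + 1) * q * κ = r * q * κ + q * κ := by ring
    have p4 := Packs.split (R := {z : ℝ × ℝ | r * a ≤ z.1 ∧ r * q * κ ≤ z.2 - τ * z.1 ∧
        z.2 - τ' * z.1 ≤ M ∧ z.1 ≤ w + t * z.2}) (-τ) 1 ((r + 1) * q * κ) (Or.inr one_ne_zero) p1 p3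
      (fun z hz => ⟨hz.1, hz.2.1, hz.2.2.2⟩)
      (fun z hz => ⟨hz.1, by linarith [hz.2.1], hz.2.2⟩)
      (fun z hz => by linarith [hz.2.2.1])
      (fun z hz => by linarith [hz.2.1])
    refine p4.mono le_rfl (le_of_eq ?_)
    push_cast
    rw [hn']
    ring

-- The upper tooth, similar to the lower one but with rows of slope `τ'` under a top line of slope
-- `τ`. All rows now start at the left side, and the columns are removed at the right, leaning
-- parallel to that side; a column then has horizontal width `1 / γ`. Rows hold one square more than
-- in the lower tooth, because the right side has already receded by about `t * M₀`. `hT` bounds how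
-- far to the right the tooth reaches.
set_option maxHeartbeats 2000000 in
theorem packs_toothB_aux {q a w : ℕ} {c s τ κ τ' M₀ M t γ σ : ℝ} (hcs : c ^ 2 + s ^ 2 = 1)
    (hc : 0 < c) (hs : 0 ≤ s) (hτ : s = τ' * c) (hκ : κ * c = 1) (hτ0 : 0 ≤ τ) (hττ' : τ ≤ τ')
    (ht : 0 ≤ t) (hγσ : γ ^ 2 + σ ^ 2 = 1) (hγ : 0 < γ) (hσ : σ = t * γ) (hM₀ : 0 ≤ M₀)
    (htτ' : t * τ' < 1) (hw : q * a / γ ≤ w)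
    (hT : ∀ r : ℕ, r < q → t * (M₀ + (r + 1) * q * κ + t + τ' + τ' * (w + 3)) ≤ 3)
    (hV : ∀ r : ℕ, r < q → M₀ + (r + 1) * q * κ + t + τ' + (τ' - τ) * (w + 3 - r * a) +
      (q - 1 - r) * q ≤ M)
    (hH : ∀ r : ℕ, r < q → s + c * (w + 2 - r * a) ≤ w - r * a / γ + t * (M₀ + r * q)) :
    ∀ k r : ℕ, r + k = q → Packs {z | 0 ≤ z.1 ∧ M₀ + r * q * κ ≤ z.2 - τ' * z.1 ∧
      z.2 - τ * z.1 ≤ M ∧ z.1 - t * z.2 ≤ w - r * a / γ} (q * k * (w + 2 - r * a)) := by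
  have hc1 : c ≤ 1 := by nlinarith [sq_nonneg s]
  have hs1 : s ≤ 1 := by nlinarith [sq_nonneg c]
  have hκ1 : 1 ≤ κ := by nlinarith
  have hγ1 : γ ≤ 1 := by nlinarith [sq_nonneg σ]
  have hσ0 : 0 ≤ σ := hσ ▸ mul_nonneg ht hγ.le
  have hσt : σ ≤ t := hσ ▸ mul_le_of_le_one_right ht hγ1
  have hτ'0 : 0 ≤ τ' := hτ0.trans hττ'
  have hδ : 0 ≤ τ' - τ := by linarith
  have hqa0 : (0 : ℝ) ≤ q * a := by positivity
  have hqa : (q * a : ℝ) ≤ w := by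
    refine le_trans ?_ hw
    rw [le_div_iff₀ hγ]
    exact mul_le_of_le_one_right hqa0 hγ1
  have hqaN : q * a ≤ w := by exact_mod_cast hqa
  intro k
  induction k with
  | zero => intro r hr; exact Packs.of_nonpos _ (by simp)
  | succ k ih =>
    intro r hr
    have hrq : r < q := by omega
    have hq : (q : ℝ) = r + 1 + k := by rw [← hr]; push_cast; ring
    have hra : (r + 1) * a ≤ w := (Nat.mul_le_mul_right a (by omega)).trans hqaN
    obtain ⟨n, hn⟩ := Nat.exists_eq_add_of_le hra
    have hn' : (w : ℝ) = (r + 1) * a + n := by rw [hn]; push_cast; ring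
    have hT := hT r hrq
    have hV := hV r hrq
    have hH := hH r hrq
    have ihr := ih (r + 1) (by omega)
    have ha0 : (0 : ℝ) ≤ a := a.cast_nonneg
    have hr0 : (0 : ℝ) ≤ r := r.cast_nonneg
    have hq0 : (0 : ℝ) ≤ q := q.cast_nonneg
    have hk0 : (0 : ℝ) ≤ k := k.cast_nonneg
    have hn0 : (0 : ℝ) ≤ n := n.cast_nonneg
    have hra0 : (0 : ℝ) ≤ r * a := mul_nonneg hr0 ha0
    have hrq0 : (0 : ℝ) ≤ r * q := mul_nonneg hr0 hq0
    have hkq0 : (0 : ℝ) ≤ k * q := mul_nonneg hk0 hq0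
    have hrqκ : (r : ℝ) * q ≤ r * q * κ := le_mul_of_one_le_right hrq0 hκ1
    have hqκ : (0 : ℝ) ≤ q * κ := by positivity
    have ek : ((q : ℝ) - 1 - r) * q = k * q := by rw [hq]; ring
    rw [ek] at hV
    set B : ℝ := M₀ + (r + 1) * q * κ with hB
    have hB0 : 0 ≤ B := by positivity
    have e9 : B = M₀ + r * q * κ + q * κ := by rw [hB]; ring
    have hraγ : (r * a : ℝ) ≤ r * a / γ := by
      rw [le_div_iff₀ hγ]
      exact mul_le_of_le_one_right hra0 hγ1
    have hraγ' : (r * a : ℝ) / γ ≤ (r + 1) * a / γ := by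
      apply div_le_div_of_nonneg_right _ hγ.le
      linarith
    have hraγ'' : ((r + 1) * a : ℝ) / γ ≤ w := by
      refine le_trans (div_le_div_of_nonneg_right ?_ hγ.le) hw
      exact mul_le_mul_of_nonneg_right (by linarith) ha0
    -- the tilted rows
    have p1 : Packs {z : ℝ × ℝ | 0 ≤ z.1 ∧ M₀ + r * q * κ ≤ z.2 - τ' * z.1 ∧
        z.2 - τ' * z.1 ≤ B ∧ z.2 - τ * z.1 ≤ M ∧ z.1 - t * z.2 ≤ w - r * a / γ}
        (q * (n + a + 2 : ℕ)) := by
      refine packs_tilted_rows hcs hc hs hτ hκ 0 (c * M₀ + r * q) q _ ?_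
      intro x y h1 h2 h3 h4
      have e2 : ((n + a + 2 : ℕ) : ℝ) = w + 2 - r * a := by rw [hn']; push_cast; ring
      have h20 : 0 ≤ (w : ℝ) + 2 - r * a := by rw [← e2]; positivity
      rw [e2] at h2
      have e1 : (c * M₀ + r * q : ℝ) * κ = M₀ + r * q * κ := by
        linear_combination M₀ * hκ
      have e3 : (c * M₀ + r * q + q : ℝ) * κ = B := by
        rw [hB]
        linear_combination M₀ * hκ
      rw [e1] at h3
      rw [e3] at h4
      have h6 : 0 ≤ τ' * x := mul_nonneg hτ'0 h1
      have h7 : t * (M₀ + r * q) ≤ t * y := mul_le_mul_of_nonneg_left (by linarith) ht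
      have h8 : x ≤ w + 3 - r * a := by
        have := mul_le_of_le_one_left h20 hc1
        linarith
      have h9 := mul_le_mul_of_nonneg_left h8 hδ
      refine ⟨h1, h3, h4, ?_, ?_⟩
      · show y - τ * x ≤ M
        linarith
      · show x - t * y ≤ _
        linarith
    -- the tilted columns
    have p2 : Packs {z : ℝ × ℝ | 0 ≤ z.1 ∧ w - (r + 1) * a / γ ≤ z.1 - t * z.2 ∧
        z.1 - t * z.2 ≤ w - r * a / γ ∧ B ≤ z.2 - τ' * z.1 ∧ z.2 - τ * z.1 ≤ M}
        (a * (k * q : ℕ)) := by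
      have hd : 0 < γ - τ' * σ := by
        have := mul_pos hγ (sub_pos.mpr htτ')
        rw [hσ]
        linarith
      have hd' : 0 ≤ γ - τ * σ := by linarith [mul_nonneg hδ hσ0]
      -- The offset puts the lower right corner of each leaning column on the line `y - τ' x = B`.
      refine Packs.bars (c := σ) (s := γ) (by linarith) (-(γ * w) + r * a) a _
        (fun j => (B - (σ + τ' * γ) * (-(γ * w) + r * a + j)) / (γ - τ' * σ)) ?_
      intro j hj ξ η h1 h2 h3 h4
      have hj' : (j : ℝ) + 1 ≤ a := by exact_mod_cast hj
      have hj0 : (0 : ℝ) ≤ j := j.cast_nonneg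
      push_cast at h2
      set η₁ : ℝ := -(γ * w) + r * a + j with hη₁
      set o : ℝ := (B - (σ + τ' * γ) * η₁) / (γ - τ' * σ) with ho
      have ho' : o * (γ - τ' * σ) = B - (σ + τ' * γ) * η₁ := div_mul_cancel₀ _ hd.ne'
      have hf0 : 0 ≤ σ + τ' * γ := by positivity
      have hf0' : 0 ≤ σ + τ * γ := by positivity
      -- the distance from the slanted right side
      have ex : γ * (σ * ξ - γ * η - t * (γ * ξ + σ * η)) = -η := by
        rw [hσ] at hγσ ⊢
        linear_combination (-η) * hγσ
      have gl : w - (r + 1) * a / γ ≤ σ * ξ - γ * η - t * (γ * ξ + σ * η) := by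
        rw [← mul_le_mul_iff_right₀ hγ, ex, mul_sub, mul_div_cancel₀ _ hγ.ne']
        linarith
      have gr : σ * ξ - γ * η - t * (γ * ξ + σ * η) ≤ w - r * a / γ := by
        rw [← mul_le_mul_iff_right₀ hγ, ex, mul_sub, mul_div_cancel₀ _ hγ.ne']
        linarith
      -- the lower side
      have gb : B ≤ γ * ξ + σ * η - τ' * (σ * ξ - γ * η) := by
        have a1 := mul_le_mul_of_nonneg_left h3 hf0
        have a2 := mul_le_mul_of_nonneg_right h1 hd.le
        linarith
      -- The point is at least `t` times its height to the right of the `y`-axis, and its height is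
      -- at least `τ'` times its abscissa; since `t * τ' < 1`, the height cannot be negative.
      have hy0 : 0 ≤ γ * ξ + σ * η := by
        have a1 : τ' * (0 + t * (γ * ξ + σ * η)) ≤ τ' * (σ * ξ - γ * η) :=
          mul_le_mul_of_nonneg_left (by linarith) hτ'0
        have a2 : 0 ≤ (γ * ξ + σ * η) * (1 - t * τ') := by linarith
        exact nonneg_of_mul_nonneg_left a2 (by linarith)
      have hx0 : 0 ≤ σ * ξ - γ * η := by
        have := mul_nonneg ht hy0
        linarith
      -- the left bottom corner
      set xb : ℝ := σ * o - γ * (η₁ + 1) with hxb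
      -- The height of the corner is itself affine in `xb`, so the bound coming from the right side
      -- becomes a linear inequality with factor `1 - t * τ'`, and `hT` bounds its constant term.
      have hxb' : xb ≤ w + 3 - r * a := by
        have exb : γ * (xb - t * (γ * o + σ * (η₁ + 1))) = -(η₁ + 1) := by
          rw [hxb, hσ]
          rw [hσ] at hγσ
          linear_combination (-(η₁ + 1)) * hγσ
        have b1 : xb - t * (γ * o + σ * (η₁ + 1)) ≤ w - r * a / γ := by
          rw [← mul_le_mul_iff_right₀ hγ, exb, mul_sub, mul_div_cancel₀ _ hγ.ne']
          linarith
        have b2 : γ * o + σ * (η₁ + 1) - τ' * xb = B + (σ + τ' * γ) := by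
          rw [hxb]
          linear_combination ho'
        have b3 : t * (γ * o + σ * (η₁ + 1)) = t * (B + (σ + τ' * γ)) + t * τ' * xb := by
          linear_combination t * b2
        have b4 : σ + τ' * γ ≤ t + τ' := by
          have := mul_le_of_le_one_right hτ'0 hγ1
          linarith
        have b5 := mul_le_mul_of_nonneg_left b4 ht
        have b6 : xb * (1 - t * τ') ≤ (w + 3 - r * a) * (1 - t * τ') := by
          have : 0 ≤ t * τ' * (r * a) := by positivity
          linarith
        exact le_of_mul_le_mul_right b6 (by linarith)
      have gt : γ * ξ + σ * η - τ * (σ * ξ - γ * η) ≤ M := by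
        have a1 := mul_le_mul_of_nonneg_left h4 hf0'
        have a2 := mul_le_mul_of_nonneg_right h2 hd'
        have a3 := mul_le_mul_of_nonneg_left hxb' hδ
        have a4 : (k * q : ℝ) * (γ - τ * σ) ≤ k * q := by
          apply mul_le_of_le_one_right hkq0
          have := mul_nonneg hτ0 hσ0
          linarith
        have a5 : σ + τ' * γ ≤ t + τ' := by
          have := mul_le_of_le_one_right hτ'0 hγ1
          linarith
        have a6 : (γ - τ * σ) * o + (σ + τ * γ) * (η₁ + 1) =
            B + (τ' - τ) * xb + (σ + τ' * γ) := by
          rw [hxb]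
          linear_combination ho'
        linarith
      exact ⟨hx0, gl, gr, gb, gt⟩
    have p3 := Packs.split (R := {z : ℝ × ℝ | 0 ≤ z.1 ∧ B ≤ z.2 - τ' * z.1 ∧
        z.2 - τ * z.1 ≤ M ∧ z.1 - t * z.2 ≤ w - r * a / γ}) 1 (-t) (w - (r + 1) * a / γ)
      (Or.inl one_ne_zero) ihr p2
      (fun z hz => by
          obtain ⟨h1, h2, h3, h4⟩ := hz
          push_cast at h2 h4
          exact ⟨h1, h2, h3, by linarith⟩)
      (fun z hz => ⟨hz.1, hz.2.2.2.1, hz.2.2.2.2, hz.2.2.1⟩)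
      (fun z hz => by
          have := hz.2.2.2
          push_cast at this
          linarith)
      (fun z hz => by linarith [hz.2.1])
    have p4 := Packs.split (R := {z : ℝ × ℝ | 0 ≤ z.1 ∧ M₀ + r * q * κ ≤ z.2 - τ' * z.1 ∧
        z.2 - τ * z.1 ≤ M ∧ z.1 - t * z.2 ≤ w - r * a / γ}) (-τ') 1 B (Or.inr one_ne_zero) p1 p3
      (fun z hz => ⟨hz.1, hz.2.1, hz.2.2.2⟩)
      (fun z hz => ⟨hz.1, by linarith [hz.2.1], hz.2.2⟩)
      (fun z hz => by linarith [hz.2.2.1])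
      (fun z hz => by linarith [hz.2.1])
    refine p4.mono le_rfl (le_of_eq ?_)
    push_cast
    rw [hn']
    ring

/-! ### Parameters, and a pair of teeth. -/

/-- The height of a pair of teeth, at the top of which the right side has moved by `2`. -/
noncomputable def period (q : ℕ) : ℝ := 2 * (q : ℝ) ^ 2 + 1 / 2 + 10 / q

/-- The width of a tooth. -/
def baseWidth (q : ℕ) : ℕ := (q + 4) * (2 * q)

/-- The tangent of the inclination of the right side of a tooth. -/
noncomputable def sideSlope (q : ℕ) : ℝ := 2 / period q

theorem period_pos (q : ℕ) : 0 < period q := by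
  unfold period
  positivity

theorem sideSlope_pos (q : ℕ) : 0 < sideSlope q := div_pos two_pos (period_pos q)

theorem sideSlope_mul_period (q : ℕ) : sideSlope q * period q = 2 :=
  div_mul_cancel₀ _ (period_pos q).ne'

theorem sideSlope_le {q : ℕ} (hq : 0 < q) : sideSlope q ≤ (1 / q : ℝ) ^ 2 := by
  have hq' : (0 : ℝ) < q := by exact_mod_cast hq
  have : 2 * (q : ℝ) ^ 2 ≤ period q := by
    have : (0 : ℝ) ≤ 10 / q := by positivity
    unfold period
    linarith
  rw [sideSlope, div_le_iff₀ (period_pos q)]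
  calc (2 : ℝ) = (1 / q : ℝ) ^ 2 * (2 * (q : ℝ) ^ 2) := by field_simp
    _ ≤ _ := mul_le_mul_of_nonneg_left this (by positivity)

/-- `κ`, the secant, is the vertical thickness of a row of unit squares of slope `τ`. -/
theorem exists_cos_sin_of_tan {τ : ℝ} (hτ : 0 ≤ τ) : ∃ c s κ : ℝ, c ^ 2 + s ^ 2 = 1 ∧ 0 < c ∧
    c ≤ 1 ∧ 0 ≤ s ∧ s = τ * c ∧ s ≤ τ ∧ κ * c = 1 ∧ κ ≤ 1 + τ ^ 2 / 2 ∧ κ ^ 2 = 1 + τ ^ 2 ∧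
    1 ≤ κ := by
  have h0 : 0 < 1 + τ ^ 2 := by positivity
  set κ := √(1 + τ ^ 2) with hκ
  have hκ2 : κ ^ 2 = 1 + τ ^ 2 := Real.sq_sqrt h0.le
  have hκ0 : 0 < κ := Real.sqrt_pos.mpr h0
  have hκ1 : 1 ≤ κ := by nlinarith [sq_nonneg τ]
  have hc1 : κ⁻¹ ≤ 1 := inv_le_one_of_one_le₀ hκ1
  refine ⟨κ⁻¹, τ * κ⁻¹, κ, ?_, by positivity, hc1, by positivity, rfl,
    mul_le_of_le_one_right hτ hc1, mul_inv_cancel₀ hκ0.ne', ?_, hκ2, hκ1⟩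
  · field_simp
    linarith
  · nlinarith [sq_nonneg (τ ^ 2)]

/-- A lower bound for the horizontal saving per unit length of a tilted row. Since `c ^ 2 * (1 + τ ^
2) = 1`, squaring reduces it to a polynomial inequality in `τ ^ 2`. -/
theorem one_sub_cos_ge {τ c κ : ℝ} (hc : κ * c = 1) (hκ : κ ^ 2 = 1 + τ ^ 2)
    (hτ1 : τ ^ 2 ≤ 1) : τ ^ 2 / 2 - τ ^ 4 / 2 ≤ 1 - c := by
  have h1 : c ^ 2 * (1 + τ ^ 2) = 1 := by
    rw [← hκ]
    linear_combination (κ * c + 1) * hc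
  have hv : 0 ≤ τ ^ 2 := sq_nonneg τ
  have e : τ ^ 4 = (τ ^ 2) ^ 2 := by ring
  rw [e]
  generalize τ ^ 2 = v at *
  by_contra! h
  have hg : 0 < 1 - v / 2 + v ^ 2 / 2 := by nlinarith
  have h2 : (1 - v / 2 + v ^ 2 / 2) ^ 2 < c ^ 2 := pow_lt_pow_left₀ (by linarith) hg.le two_ne_zero
  have h3 := mul_lt_mul_of_pos_right h2 (show 0 < 1 + v by linarith)
  have h4 : 0 ≤ v ^ 2 * (1 / 4 + 3 / 4 * v - v ^ 2 / 4 + v ^ 3 / 4) := by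
    apply mul_nonneg (sq_nonneg v)
    have : v ^ 2 ≤ 1 := pow_le_one₀ hv hτ1
    have : 0 ≤ v ^ 3 := by positivity
    linarith
  linarith

-- The two teeth contribute `q² (w + 1)` and `q² (w + 2)` squares, where `w` is the base width. The
-- bound `period q - 2 / q` on the top is where the bottom line of the next pair lies once that pair
-- is moved by `(2, period q)`.
set_option maxHeartbeats 2000000 in
theorem packs_pair {q : ℕ} (hq : 1000 ≤ q) :
    Packs {z : ℝ × ℝ | 0 ≤ z.1 ∧ 0 ≤ z.2 - 1 / q * z.1 ∧
      z.2 - 1 / q * z.1 ≤ period q - 2 / q ∧ z.1 ≤ baseWidth q + sideSlope q * z.2}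
      (q ^ 2 * (2 * baseWidth q + 3)) := by
  have hQ : (1000 : ℝ) ≤ q := by exact_mod_cast hq
  have ht0 := sideSlope_pos q
  have htP := sideSlope_mul_period q
  have htu := sideSlope_le (q := q) (by omega)
  have hw : (baseWidth q : ℝ) = (q + 4) * (2 * q) := by simp [baseWidth]
  rw [period] at htP ⊢
  obtain ⟨u, hu⟩ : ∃ u : ℝ, u = 1 / q := ⟨_, rfl⟩
  have hQu : (q : ℝ) * u = 1 := by rw [hu]; field_simp
  have hu0 : 0 < u := by rw [hu]; positivity
  have hu1 : u ≤ 1 / 1000 := by rw [hu]; exact one_div_le_one_div_of_le (by norm_num) hQ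
  have e10 : (10 / q : ℝ) = 10 * u := by rw [hu]; ring
  have e2 : (2 / q : ℝ) = 2 * u := by rw [hu]; ring
  rw [← hu, e2, e10]
  rw [← hu] at htu
  rw [e10] at htP
  set t := sideSlope q with ht
  have hQu2 : (q : ℝ) ^ 2 * u ^ 2 = 1 := by rw [← mul_pow, hQu, one_pow]
  have hu2 : u ^ 2 ≤ u / 1000 := by nlinarith
  have htQ : 1 - u ^ 2 / 2 ≤ t * q ^ 2 := by
    have : t * (1 / 4 + 5 * u) ≤ u ^ 2 * (1 / 4 + 5 * u) :=
      mul_le_mul_of_nonneg_right htu (by linarith)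
    have h3 : u ^ 2 * (1 / 4 + 5 * u) ≤ u ^ 2 * (1 / 2) :=
      mul_le_mul_of_nonneg_left (by linarith) (sq_nonneg u)
    linarith
  obtain ⟨c, s, κ, hcs, hc, hc1, hs, hsτ, hsu, hκc, hκ, hκ2, hκ1⟩ := exists_cos_sin_of_tan hu0.le
  -- Each stage adds about `q * u ^ 2 / 2 = u / 2` of excess row thickness while moving `2q`
  -- sideways; the extra slope `u ^ 2 / 4` absorbs exactly this.
  set τ' := u + u ^ 2 / 4 with hτ'
  have hτ'u : τ' ≤ 2 * u := by rw [hτ']; linarith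
  have hτ'0 : 0 < τ' := by positivity
  obtain ⟨c', s', κ', hcs', hc', hc1', hs', hsτ', hsu', hκc', hκ', hκ2', hκ1'⟩ :=
    exists_cos_sin_of_tan hτ'0.le
  obtain ⟨γ, σ, ι, hγσ, hγ, hγ1, hσ, hσt, hσu, hιγ, hι, hι2, hι1⟩ :=
    exists_cos_sin_of_tan ht0.le
  have hd : u ^ 2 / 2 - u ^ 4 / 2 ≤ 1 - c :=
    one_sub_cos_ge hκc hκ2 (by linarith)
  have hcc : c' ≤ c := by
    have : κ ≤ κ' := by
      apply le_of_sq_le_sq _ (by linarith)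
      rw [hκ2, hκ2']
      have : u ^ 2 ≤ τ' ^ 2 := pow_le_pow_left₀ hu0.le (by rw [hτ']; linarith [sq_nonneg u]) 2
      linarith
    have h0 := mul_nonneg (mul_nonneg hc'.le hc.le) (sub_nonneg.mpr this)
    have e0 : c' * c * (κ' - κ) = c - c' := by linear_combination c * hκc' - c' * hκc
    linarith
  have hd' : u ^ 2 / 2 - u ^ 4 / 2 ≤ 1 - c' := by linarith
  have ha : ((2 * q : ℕ) : ℝ) = 2 * q := by push_cast; ring
  set w := baseWidth q with hwdef
  have hinv : ∀ x : ℝ, x / γ = x * ι := by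
    intro x
    rw [div_eq_iff hγ.ne', mul_assoc, hιγ, mul_one]
  have hιu : ι ≤ 1 + u ^ 4 / 2 := by
    have : t ^ 2 ≤ (u ^ 2) ^ 2 := pow_le_pow_left₀ ht0.le htu 2
    linarith
  have hρ : ∀ r : ℕ, r < q → (r : ℝ) * u ≤ 1 - u ∧ 0 ≤ (r : ℝ) * u := by
    intro r hr
    have : (r : ℝ) + 1 ≤ q := by exact_mod_cast hr
    have := mul_le_mul_of_nonneg_right this hu0.le
    exact ⟨by linarith, by positivity⟩
  -- The saving by tilting in stage `r`. The leading `1` is the additional square in the row; the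
  -- surplus `4 * u`, due to the summand `4` in `baseWidth`, pays for the slanted row ends and the
  -- errors.
  have hgain : ∀ r : ℕ, r < q → 1 + 4 * u - r * u - 2 * u ^ 2 ≤
      (w + 1 - r * (2 * q)) * (u ^ 2 / 2 - u ^ 4 / 2) := by
    intro r hr
    have e : (w + 1 - r * (2 * q) : ℝ) * (u ^ 2 / 2 - u ^ 4 / 2) =
        (1 + 4 * u - r * u) * (1 - u ^ 2) + u ^ 2 * (1 - u ^ 2) / 2 := by
      rw [hw]
      linear_combination ((q * u + 1) + 4 * u - r * u) * (1 - u ^ 2) * hQu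
    have h1 : (1 + 4 * u - r * u) * u ^ 2 ≤ 2 * u ^ 2 :=
      mul_le_mul_of_nonneg_right (by linarith [hρ r hr]) (sq_nonneg u)
    have h2 : 0 ≤ u ^ 2 * (1 - u ^ 2) := mul_nonneg (sq_nonneg u) (by linarith)
    linarith
  have hlen : ∀ r : ℕ, r < q → 0 ≤ (w + 1 - r * (2 * q) : ℝ) := by
    intro r hr
    have h1 : (r : ℝ) ≤ q := by exact_mod_cast hr.le
    have h2 : (r : ℝ) * (2 * q) ≤ q * (2 * q) := mul_le_mul_of_nonneg_right h1 (by linarith)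
    rw [hw]
    linarith
  have hrise : ∀ r : ℕ, r < q → r * u - u ^ 2 / 2 ≤ t * (r * q) := by
    intro r hr
    have e : t * (r * q) = t * q ^ 2 * (r * u) := by linear_combination (-(t * r * q)) * hQu
    have h1 := mul_le_mul_of_nonneg_right htQ (hρ r hr).2
    have h2 : u ^ 2 / 2 * (r * u) ≤ u ^ 2 / 2 :=
      mul_le_of_le_one_right (by positivity) (by linarith [hρ r hr])
    linarith
  have hrow : ∀ r : ℕ, r < q → ((r : ℝ) + 1) * q * κ' ≤ (r + 1) * q + r * u / 2 + u := by
    intro r hr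
    have h1 : κ' ≤ 1 + (u ^ 2 + u ^ 3) / 2 := by
      have : τ' ^ 2 ≤ u ^ 2 + u ^ 3 := by
        have : 0 ≤ u ^ 3 * (1 / 2 - u / 16) := mul_nonneg (by positivity) (by linarith)
        rw [hτ']
        linarith
      linarith
    have h2 := mul_le_mul_of_nonneg_left h1 (show 0 ≤ ((r : ℝ) + 1) * q by positivity)
    have e : ((r : ℝ) + 1) * q * (1 + (u ^ 2 + u ^ 3) / 2) =
        (r + 1) * q + (r * u + u) / 2 + (r * u + u) * u / 2 := by
      linear_combination ((r + 1) * u / 2 + (r + 1) * u ^ 2 / 2) * hQu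
    have h3 : (r * u + u) * u ≤ 1 * u :=
      mul_le_mul_of_nonneg_right (by linarith [hρ r hr]) hu0.le
    linarith
  have hτ'sub : τ' - u = u ^ 2 / 4 := by rw [hτ']; ring
  have hA := packs_toothA_aux (q := q) (a := 2 * q) (w := w) (τ' := τ')
    (M := q ^ 2 + 3 / 2 * u) (t := t) hcs hc hs hsτ hκc
    (by rw [hτ']; linarith [sq_nonneg u]) ht0.le ?_ ?_ ?_ q 0 (by omega)
  -- The summand `1 / 2` in `period` is the rise of the steeper dividing line, `u ^ 2 / 4` times a
  -- width of `2q²`; the summand `10 * u` covers all errors of order `u` and the offset `2 * u`.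
  have hVB : ∀ r : ℕ, r < q → q ^ 2 + 3 / 2 * u + (r + 1) * q * κ' + t + τ' +
      (τ' - u) * (w + 3 - r * (2 * q : ℕ)) + (q - 1 - r) * q ≤
        2 * (q : ℝ) ^ 2 + 1 / 2 + 10 * u - 2 * u := by
    intro r hr
    rw [ha, hτ'sub]
    have e : u ^ 2 / 4 * (w + 3 - r * (2 * q)) = 1 / 2 + 2 * u + 3 * u ^ 2 / 4 - r * u / 2 := by
      rw [hw]
      linear_combination ((q * u + 1) / 2 + 2 * u - r * u / 2) * hQu
    linarith [hrow r hr]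
  have hTB : ∀ r : ℕ, r < q → t * (q ^ 2 + 3 / 2 * u + (r + 1) * q * κ' + t + τ' +
      τ' * (w + 3)) ≤ 3 := by
    intro r hr
    have h1 : ((r : ℝ) + 1) * q ≤ q * q :=
      mul_le_mul_of_nonneg_right (by exact_mod_cast hr) (by linarith)
    have h2 : τ' * (w + 3) ≤ 2 * u * (w + 3) := mul_le_mul_of_nonneg_right hτ'u (by positivity)
    have e2 : 2 * u * (w + 3) = 4 * q + 16 + 6 * u := by
      rw [hw]
      linear_combination (4 * q + 16) * hQu
    have h3 : q ^ 2 + 3 / 2 * u + (r + 1) * q * κ' + t + τ' + τ' * (w + 3) ≤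
        2 * (q : ℝ) ^ 2 + 4 * q + 20 := by
      linarith [hrow r hr, hρ r hr]
    have h4 : t * (q ^ 2 + 3 / 2 * u + (r + 1) * q * κ' + t + τ' + τ' * (w + 3)) ≤
        u ^ 2 * (2 * (q : ℝ) ^ 2 + 4 * q + 20) :=
      mul_le_mul htu h3 (by positivity) (sq_nonneg u)
    have e4 : u ^ 2 * (2 * (q : ℝ) ^ 2 + 4 * q + 20) = 2 + 4 * u + 20 * u ^ 2 := by
      linear_combination 2 * hQu2 + 4 * u * hQu
    linarith
  have htτ : t * τ' < 1 :=
    mul_lt_one_of_nonneg_of_lt_one_left ht0.le (by linarith) (by linarith)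
  have hB := packs_toothB_aux (q := q) (a := 2 * q) (w := w) (τ := u) (τ' := τ')
    (M₀ := q ^ 2 + 3 / 2 * u) (M := 2 * (q : ℝ) ^ 2 + 1 / 2 + 10 * u - 2 * u) (t := t)
    hcs' hc' hs' hsτ' hκc' hu0.le (by rw [hτ']; linarith [sq_nonneg u]) ht0.le hγσ hγ hσt
    (by positivity) htτ ?_ hTB hVB ?_ q 0 (by omega)
  · refine (Packs.split (R := {z : ℝ × ℝ | 0 ≤ z.1 ∧ 0 ≤ z.2 - u * z.1 ∧
      z.2 - u * z.1 ≤ 2 * (q : ℝ) ^ 2 + 1 / 2 + 10 * u - 2 * u ∧ z.1 ≤ w + t * z.2})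
      (-τ') 1 (q ^ 2 + 3 / 2 * u) (Or.inr one_ne_zero) hA hB ?_ ?_ ?_ ?_).mono le_rfl ?_
    · intro z hz
      simp only [Set.mem_ofPred_eq, Nat.cast_zero, zero_mul] at hz ⊢
      obtain ⟨h1, h2, h3, h4⟩ := hz
      refine ⟨h1, h2, ?_, h4⟩
      -- Below the dividing line, `T0` bounds the abscissa by `w + 3`, and `V0` then places the
      -- lower tooth under the top line of the pair.
      have T0 := hTB 0 (by omega)
      have V0 := hVB 0 (by omega)
      simp only [Nat.cast_zero, zero_mul, zero_add, sub_zero, one_mul] at T0 V0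
      have g0 : 0 ≤ (q : ℝ) * κ' := by positivity
      have g1 : 0 ≤ t * (q * κ' + t + τ') := by positivity
      have g2 : t * z.2 ≤ t * (q ^ 2 + 3 / 2 * u + τ' * z.1) :=
        mul_le_mul_of_nonneg_left (by linarith) ht0.le
      have g3 : z.1 * (1 - t * τ') ≤ (w + 3) * (1 - t * τ') := by linarith
      have g4 := le_of_mul_le_mul_right g3 (by linarith)
      have g5 : (τ' - u) * z.1 ≤ (τ' - u) * (w + 3) :=
        mul_le_mul_of_nonneg_left g4 (by rw [hτ'sub]; positivity)
      have g6 : 0 ≤ ((q : ℝ) - 1) * q := mul_nonneg (by linarith) (by linarith)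
      linarith
    · intro z hz
      simp only [Set.mem_ofPred_eq, Nat.cast_zero, zero_mul, zero_div, add_zero, sub_zero] at hz ⊢
      obtain ⟨h1, h2, h3, h4⟩ := hz
      refine ⟨h1, ?_, h3, by linarith⟩
      have : 0 ≤ (τ' - u) * z.1 := mul_nonneg (by rw [hτ']; linarith [sq_nonneg u]) h1
      have : 0 ≤ (q : ℝ) ^ 2 := by positivity
      linarith
    · intro z hz
      linarith [hz.2.2.1]
    · intro z hz
      have := hz.2.1
      simp only [Nat.cast_zero, zero_mul, add_zero] at this
      linarith
    · push_cast
      apply le_of_eq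
      ring
  · rw [hinv, hw, ha]
    have h1 := mul_le_mul_of_nonneg_left hιu (show 0 ≤ (q : ℝ) * (2 * q) by positivity)
    have e : (q : ℝ) * (2 * q) * (1 + u ^ 4 / 2) = q * (2 * q) + u ^ 2 := by
      linear_combination u ^ 2 * hQu2
    linarith
  · intro r hr
    rw [hinv, ha]
    have h1 := mul_le_mul_of_nonneg_left hd' (hlen r hr)
    have h2 : (r * (2 * q) : ℝ) * (ι - 1) ≤ u ^ 2 := by
      have g1 : (r : ℝ) * (2 * q) ≤ q * (2 * q) :=
        mul_le_mul_of_nonneg_right (by exact_mod_cast hr.le) (by linarith)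
      calc (r * (2 * q) : ℝ) * (ι - 1) ≤ q * (2 * q) * (u ^ 4 / 2) :=
            mul_le_mul g1 (by linarith) (by linarith) (by positivity)
        _ = u ^ 2 := by linear_combination u ^ 2 * hQu2
    have h3 : 0 ≤ t * (3 / 2 * u) := by positivity
    linarith [hgain r hr, hrise r hr]
  · rw [hwdef, baseWidth]
    exact Nat.mul_le_mul_right _ (by omega)
  · intro r hr
    rw [ha, hτ'sub]
    have h1 := mul_le_mul_of_nonneg_left hκ (show 0 ≤ ((r : ℝ) + 1) * q by positivity)
    have e1 : ((r : ℝ) + 1) * q * (1 + u ^ 2 / 2) = (r + 1) * q + (r * u + u) / 2 := by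
      linear_combination ((r + 1) * u / 2) * hQu
    have e2 : u ^ 2 / 4 * (r * (2 * q)) = r * u / 2 := by
      linear_combination (r * u / 2) * hQu
    linarith
  · intro r hr
    rw [ha]
    have h1 := mul_le_mul_of_nonneg_left hd (hlen r hr)
    linarith [hgain r hr, hrise r hr]

/-! ### Stacking pairs of teeth into a trapezoid. -/

theorem cast_baseWidth (q : ℕ) : (baseWidth q : ℝ) = (q + 4) * (2 * q) := by simp [baseWidth]

theorem le_period (q : ℕ) : 2 * (q : ℝ) ^ 2 ≤ period q := by
  have : (0 : ℝ) ≤ 10 / q := by positivity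
  unfold period
  linarith

theorem period_le {q : ℕ} (hq : 1000 ≤ q) : period q ≤ 2 * (q : ℝ) ^ 2 + 1 := by
  have hQ : (1000 : ℝ) ≤ q := by exact_mod_cast hq
  have : (10 / q : ℝ) ≤ 1 / 2 := by
    rw [div_le_iff₀ (by linarith)]
    linarith
  unfold period
  linarith

/-- Packing of a trapezoid whose right side has the small slope `sideSlope q`, by stacking pairs
of teeth. -/
theorem packs_stacked_teeth {q : ℕ} (hq : 1000 ≤ q) (j : ℕ) : ∀ h : ℝ, 0 ≤ h →
    h ≤ period q + 4 * q + j * period q →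
    Packs {z : ℝ × ℝ | 0 ≤ z.1 ∧ 0 ≤ z.2 - 1 / q * z.1 ∧ z.2 ≤ h ∧
      z.1 ≤ baseWidth q + sideSlope q * z.2}
      (baseWidth q * h + h ^ 2 / period q - 10 * q ^ 3 - j * (30 * q)) := by
  have hQ : (1000 : ℝ) ≤ q := by exact_mod_cast hq
  have hP0 := period_pos q
  have hP1 := le_period q
  have hP2 := period_le hq
  have hPd : period q = 2 * (q : ℝ) ^ 2 + 1 / 2 + 10 / q := rfl
  have ht0 := sideSlope_pos q
  have htP := sideSlope_mul_period q
  have htu := sideSlope_le (q := q) (by omega)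
  have hw := cast_baseWidth q
  have hpair := packs_pair hq
  obtain ⟨u, hu⟩ : ∃ u : ℝ, u = 1 / q := ⟨_, rfl⟩
  have hQu : (q : ℝ) * u = 1 := by rw [hu]; field_simp
  have hu0 : 0 < u := by rw [hu]; positivity
  have hu1 : u ≤ 1 / 1000 := by rw [hu]; exact one_div_le_one_div_of_le (by norm_num) hQ
  have e10 : (10 / q : ℝ) = 10 * u := by rw [hu]; ring
  have e2 : (2 / q : ℝ) = 2 * u := by rw [hu]; ring
  rw [e10] at hPd
  rw [e2] at hpair
  rw [← hu] at htu hpair ⊢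
  set t := sideSlope q
  set P := period q
  set w := baseWidth q
  have hQ2 : 1000 * (q : ℝ) ≤ q ^ 2 := by nlinarith
  have hQ3 : 1000 * (q : ℝ) ^ 2 ≤ q ^ 3 := by nlinarith [sq_nonneg (q : ℝ)]
  have huw : u * w = 2 * q + 8 := by
    rw [hw]
    linear_combination (2 * q + 8) * hQu
  -- For small heights, upright columns above the slanted bottom are good enough: the loss `O(q³)`
  -- is incurred only once.
  have base : ∀ h : ℝ, 0 ≤ h → h ≤ P + 4 * q → Packs {z : ℝ × ℝ | 0 ≤ z.1 ∧ 0 ≤ z.2 - u * z.1 ∧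
      z.2 ≤ h ∧ z.1 ≤ w + t * z.2} (w * h + h ^ 2 / P - 10 * q ^ 3) := by
    intro h h0 h1
    refine (Packs.columns (R := {z : ℝ × ℝ | 0 ≤ z.1 ∧ 0 ≤ z.2 - u * z.1 ∧
      z.2 ≤ h ∧ z.1 ≤ w + t * z.2}) 0 (u * w) h w ?_).mono le_rfl ?_
    · intro x y h1 h2 h3 h4
      rw [zero_add] at h2
      have g1 : u * x ≤ u * w := mul_le_mul_of_nonneg_left h2 hu0.le
      have g2 : 0 ≤ t * y := mul_nonneg ht0.le (by rw [huw] at h3; linarith)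
      exact ⟨h1, by show 0 ≤ y - u * x; linarith, h4, by show x ≤ w + t * y; linarith⟩
    · have g1 : h ^ 2 / P ≤ 5 * q ^ 2 := by
        rw [div_le_iff₀ hP0]
        calc h ^ 2 ≤ (3 * q ^ 2 : ℝ) ^ 2 := pow_le_pow_left₀ h0 (by linarith) 2
          _ ≤ 5 * q ^ 2 * (2 * q ^ 2) := by nlinarith [sq_nonneg ((q : ℝ) ^ 2)]
          _ ≤ _ := mul_le_mul_of_nonneg_left hP1 (by positivity)
      have e : (w : ℝ) * (u * w + 1) = 4 * q ^ 3 + 34 * q ^ 2 + 72 * q := by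
        rw [huw, hw]
        ring
      linarith
  induction j with
  | zero =>
    intro h h0 h1
    simpa using base h h0 (by simpa using h1)
  | succ j ih =>
    intro h h0 h1
    by_cases hh : h ≤ P + 4 * q
    · refine (base h h0 hh).mono le_rfl ?_
      have : 0 ≤ ((j + 1 : ℕ) : ℝ) * (30 * q) := by positivity
      linarith
    · push Not at hh
      push_cast at h1
      -- Since `t * P = 2`, raising by `P` and moving right by `2` preserves the slanted side. The
      -- gap of width `2` on the left takes two upright columns.
      have p1 := (ih (h - P) (by linarith) (by linarith)).translate
        (R' := {z : ℝ × ℝ | 2 ≤ z.1 ∧ P - 2 * u ≤ z.2 - u * z.1 ∧ z.2 ≤ h ∧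
          z.1 ≤ w + t * z.2}) (2, P) (by
            intro z hz
            obtain ⟨h1, h2, h3, h4⟩ := hz
            simp only [Set.mem_ofPred_eq]
            exact ⟨by linarith, by linarith, by linarith, by linarith⟩)
      have p2 := Packs.columns (R := {z : ℝ × ℝ | 0 ≤ z.1 ∧ z.1 ≤ 2 ∧
          P - 2 * u ≤ z.2 - u * z.1 ∧ z.2 ≤ h ∧ z.1 ≤ w + t * z.2}) 0 P h 2 (by
            intro x y h1 h2 h3 h4
            push_cast at h2
            have g1 : u * x ≤ u * 2 := mul_le_mul_of_nonneg_left (by linarith) hu0.le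
            have g2 : 0 ≤ t * y := mul_nonneg ht0.le (by linarith)
            refine ⟨h1, by linarith, ?_, h4, ?_⟩
            · show P - 2 * u ≤ y - u * x
              linarith
            · show x ≤ w + t * y
              rw [hw]
              linarith)
      have p3 := Packs.split (R := {z : ℝ × ℝ | 0 ≤ z.1 ∧ P - 2 * u ≤ z.2 - u * z.1 ∧ z.2 ≤ h ∧
          z.1 ≤ w + t * z.2}) 1 0 2 (Or.inl one_ne_zero) p2 p1
        (fun z hz => ⟨hz.1, hz.2.2⟩) (fun z hz => ⟨by linarith [hz.1], hz.2⟩)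
        (fun z hz => by linarith [hz.2.1]) (fun z hz => by linarith [hz.1])
      have p4 := Packs.split (R := {z : ℝ × ℝ | 0 ≤ z.1 ∧ 0 ≤ z.2 - u * z.1 ∧ z.2 ≤ h ∧
          z.1 ≤ w + t * z.2}) (-u) 1 (P - 2 * u) (Or.inr one_ne_zero) hpair p3
        (fun z hz => by
          obtain ⟨h1, h2, h3, h4⟩ := hz
          refine ⟨h1, h2, ?_, h4⟩
          -- The slanted bottom rises by only about `u * w = 2 * q + 8` across the width, so the
          -- margin `4 * q` keeps the whole pair below height `h`.
          by_contra! hz2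
          have hut : u * t ≤ 1 := by
            have : u * t ≤ 1 * 1 := mul_le_mul (by linarith) (by nlinarith) ht0.le (by norm_num)
            linarith
          have g1 : u * z.1 ≤ u * (w + t * z.2) := mul_le_mul_of_nonneg_left h4 hu0.le
          have g2 : (P + 4 * q) * (1 - u * t) ≤ z.2 * (1 - u * t) :=
            mul_le_mul_of_nonneg_right (by linarith) (by linarith)
          have e : (P + 4 * q) * (1 - u * t) = P + 4 * q - 2 * u - 4 * t := by
            linear_combination (-u) * htP - 4 * t * hQu
          have : t ≤ 1 := by nlinarith
          linarith)
        (fun z hz => ⟨hz.1, by linarith [hz.2.1], hz.2.2⟩)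
        (fun z hz => by linarith [hz.2.2.1]) (fun z hz => by linarith [hz.2.1])
      refine p4.mono le_rfl ?_
      have e1 : (h - P) ^ 2 / P = h ^ 2 / P - 2 * h + P := by field_simp; ring
      -- With this value the terms of order `q²` in area minus count cancel, leaving `24 * q + O(1)`
      -- for the layer, which `30 * q` covers.
      have e2 : (w : ℝ) * P = 2 * q ^ 2 * w + q ^ 2 + 24 * q + 80 := by
        rw [hPd, hw]
        linear_combination (20 * q + 80) * hQu
      rw [e1]
      push_cast
      linarith

/-- At most `15 q²` layers, each losing at most `30 q`, give `450 q³`; the base adds `10 q³`. -/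
theorem packs_wedge {q : ℕ} (hq : 1000 ≤ q) {h : ℝ} (h0 : 0 ≤ h) (h1 : h ≤ 28 * q ^ 4) :
    Packs {z : ℝ × ℝ | 0 ≤ z.1 ∧ 0 ≤ z.2 ∧ z.2 ≤ h ∧ z.1 ≤ baseWidth q + sideSlope q * z.2}
      (baseWidth q * h + h ^ 2 / period q - 500 * q ^ 3) := by
  have hQ : (1000 : ℝ) ≤ q := by exact_mod_cast hq
  have hP0 := period_pos q
  have hP1 := le_period q
  set j := ⌈h / period q⌉₊ with hj
  have hj1 : h ≤ j * period q := by
    rw [← div_le_iff₀ hP0]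
    exact Nat.le_ceil _
  have hj2 : (j : ℝ) ≤ 15 * q ^ 2 := by
    have h2 : (j : ℝ) < h / period q + 1 := Nat.ceil_lt_add_one (by positivity)
    have h3 : h / period q ≤ 14 * q ^ 2 := by
      rw [div_le_iff₀ hP0]
      have := mul_le_mul_of_nonneg_left hP1 (show (0 : ℝ) ≤ 14 * q ^ 2 by positivity)
      linarith
    nlinarith
  refine (packs_stacked_teeth hq j h h0 (by linarith)).mono ?_ ?_
  · intro z hz
    refine ⟨hz.1, ?_, hz.2.2⟩
    have h2 := hz.2.1
    have : 0 ≤ 1 / (q : ℝ) * z.1 := mul_nonneg (by positivity) hz.1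
    linarith
  · have := mul_le_mul_of_nonneg_right hj2 (show (0 : ℝ) ≤ 30 * q by positivity)
    have : (0 : ℝ) ≤ q ^ 3 := by positivity
    linarith

/-! ### Strips. -/

/-- Bars of length `N` leaning at the same angle fill a slanted strip between two horizontals. -/
theorem packs_leaning_bars {γ σ t : ℝ} (hγσ : γ ^ 2 + σ ^ 2 = 1) (hγ : 0 < γ) (hσ : σ = t * γ)
    (ht : 0 ≤ t) (X h : ℝ) (K N : ℕ) (hN : γ * N + σ ≤ h) :
    Packs {z : ℝ × ℝ | 0 ≤ z.2 ∧ z.2 ≤ h ∧ X ≤ z.1 - t * z.2 ∧ z.1 - t * z.2 ≤ X + K / γ}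
      (K * N) := by
  have hσ0 : 0 ≤ σ := hσ ▸ mul_nonneg ht hγ.le
  refine Packs.bars (c := σ) (s := γ) (by linarith) (-(γ * X) - K) K N
    (fun k => (-(σ * (-(γ * X) - K + k))) / γ) ?_
  intro k hk ξ η h1 h2 h3 h4
  have hk' : (k : ℝ) + 1 ≤ K := by exact_mod_cast hk
  have hk0 : (0 : ℝ) ≤ k := k.cast_nonneg
  set o : ℝ := (-(σ * (-(γ * X) - K + k))) / γ with ho
  have ho' : o * γ = -(σ * (-(γ * X) - K + k)) := div_mul_cancel₀ _ hγ.ne'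
  have a1 := mul_le_mul_of_nonneg_left h1 hγ.le
  have a2 := mul_le_mul_of_nonneg_left h2 hγ.le
  have a3 := mul_le_mul_of_nonneg_left h3 hσ0
  have a4 := mul_le_mul_of_nonneg_left h4 hσ0
  have ex : γ * (σ * ξ - γ * η - t * (γ * ξ + σ * η)) = -η := by
    rw [hσ] at hγσ ⊢
    linear_combination (-η) * hγσ
  refine ⟨?_, ?_, ?_, ?_⟩
  · show 0 ≤ γ * ξ + σ * η
    linarith
  · show γ * ξ + σ * η ≤ h
    linarith
  · show X ≤ σ * ξ - γ * η - t * (γ * ξ + σ * η)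
    rw [← mul_le_mul_iff_right₀ hγ, ex]
    linarith
  · show σ * ξ - γ * η - t * (γ * ξ + σ * η) ≤ X + K / γ
    rw [← mul_le_mul_iff_right₀ hγ, ex, mul_add, mul_div_cancel₀ _ hγ.ne']
    linarith

set_option maxHeartbeats 2000000 in
/-- A long strip, of a height that is almost fitted by leaning bars, is packed efficiently. -/
theorem packs_strip {q N : ℕ} (hq : 1000 ≤ q) {γ σ h L : ℝ} (hγσ : γ ^ 2 + σ ^ 2 = 1) (hγ : 0 < γ)
    (hσ : σ = sideSlope q * γ) (hN : γ * N + σ ≤ h)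
    (hN' : h ≤ γ * N + σ + (1 / q) ^ 2) (hh : period q ≤ h) (hh' : h ≤ 28 * q ^ 4)
    (hL : L ≤ q ^ 5) (hL' : 2 * baseWidth q + sideSlope q * h ≤ L) :
    Packs (Set.Icc 0 L ×ˢ Set.Icc 0 h) (L * h - 2000 * q ^ 3) := by
  have hQ : (1000 : ℝ) ≤ q := by exact_mod_cast hq
  have hP0 := period_pos q
  have hP1 := le_period q
  have hP2 := period_le hq
  have ht0 := sideSlope_pos q
  have htP := sideSlope_mul_period q
  have htu := sideSlope_le (q := q) (by omega)
  have hw := cast_baseWidth q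
  have hh0 : 0 ≤ h := hP0.le.trans hh
  have hγ1 : γ ≤ 1 := by nlinarith [sq_nonneg σ]
  have hσt : σ ≤ sideSlope q := hσ ▸ mul_le_of_le_one_right ht0.le hγ1
  obtain ⟨u, hu⟩ : ∃ u : ℝ, u = 1 / q := ⟨_, rfl⟩
  have hQu : (q : ℝ) * u = 1 := by rw [hu]; field_simp
  have hu0 : 0 < u := by rw [hu]; positivity
  have hu1 : u ≤ 1 / 1000 := by rw [hu]; exact one_div_le_one_div_of_le (by norm_num) hQ
  rw [← hu] at htu hN'
  have hhP : h ^ 2 / period q = sideSlope q * h ^ 2 / 2 := by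
    rw [sideSlope]
    ring
  have hwedge := packs_wedge hq hh0 hh'
  rw [hhP] at hwedge
  have htinv : ∀ v : ℝ, v ^ 2 / period q = sideSlope q * v ^ 2 / 2 := by
    intro v
    rw [sideSlope]
    ring
  have hwN : 2 ≤ baseWidth q := by
    unfold baseWidth
    nlinarith
  have hleft := fun v : ℝ => fun hv : 0 ≤ v => fun hv' : v ≤ 28 * q ^ 4 => packs_wedge hq hv hv'
  simp only [htinv] at hleft
  set t := sideSlope q
  set P := period q
  set w := baseWidth q
  have hγ2 : 1 / 2 < γ := by
    have : σ ≤ 1 / 2 := by nlinarith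
    have : 0 ≤ σ := hσ ▸ mul_nonneg ht0.le hγ.le
    nlinarith
  set A := L - 2 * w - t * h with hA
  have hA0 : 0 ≤ A := by linarith
  set K := ⌈γ * A⌉₊
  have hK1 : γ * A ≤ K := Nat.le_ceil _
  have hK2 : (K : ℝ) < γ * A + 1 := Nat.ceil_lt_add_one (by positivity)
  -- Rounding up the number of bars makes the middle part too wide by `K / γ - A ≤ 2`. Raising the
  -- left trapezoid by `y₀` moves its slanted side left by this excess; `w - 2` upright columns fill
  -- the space below it.
  set y₀ := (K / γ - A) / t with hy₀
  have hty₀ : t * y₀ = K / γ - A := mul_div_cancel₀ _ ht0.ne'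
  have hK1' : A ≤ K / γ := by
    rw [le_div_iff₀ hγ]
    linarith
  have hK2' : K / γ ≤ A + 2 := by
    rw [div_le_iff₀ hγ]
    have := mul_le_mul_of_nonneg_left hγ2.le hA0
    linarith
  have hy0 : 0 ≤ y₀ := div_nonneg (by linarith) ht0.le
  have hyP : y₀ ≤ P := by
    rw [← mul_le_mul_iff_right₀ ht0]
    linarith
  have p1 := (hleft (h - y₀) (by linarith) (by linarith)).translate
    (R' := {z : ℝ × ℝ | 0 ≤ z.1 ∧ y₀ ≤ z.2 ∧ z.2 ≤ h ∧ z.1 - t * z.2 ≤ w - t * y₀}) (0, y₀) (by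
      intro z hz
      obtain ⟨h1, h2, h3, h4⟩ := hz
      simp only [Set.mem_ofPred_eq]
      exact ⟨by linarith, by linarith, by linarith, by linarith⟩)
  have p2 := Packs.columns (R := {z : ℝ × ℝ | 0 ≤ z.1 ∧ 0 ≤ z.2 ∧ z.2 ≤ y₀ ∧
      z.1 - t * z.2 ≤ w - t * y₀}) 0 0 y₀ (w - 2) (by
      intro x y h1 h2 h3 h4
      rw [Nat.cast_sub hwN] at h2
      push_cast at h2
      have : 0 ≤ t * y := mul_nonneg ht0.le h3
      refine ⟨h1, h3, h4, ?_⟩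
      show x - t * y ≤ w - t * y₀
      linarith)
  rw [Nat.cast_sub hwN] at p2
  have p3 := Packs.split (R := {z : ℝ × ℝ | 0 ≤ z.1 ∧ 0 ≤ z.2 ∧ z.2 ≤ h ∧
      z.1 - t * z.2 ≤ w - t * y₀}) 0 1 y₀ (Or.inr one_ne_zero) p2 p1
    (fun z hz => ⟨hz.1, hz.2.1, by linarith [hz.2.2.1], hz.2.2.2⟩)
    (fun z hz => ⟨hz.1, by linarith [hz.2.1], hz.2.2⟩)
    (fun z hz => by linarith [hz.2.2.1]) (fun z hz => by linarith [hz.2.1])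
  have p4 := packs_leaning_bars hγσ hγ hσ ht0.le (w - t * y₀) h K N hN
  have p5 := hwedge.pointReflect (R' := {z : ℝ × ℝ | z.1 ≤ L ∧ 0 ≤ z.2 ∧ z.2 ≤ h ∧
      L - w - t * h ≤ z.1 - t * z.2}) (L, h) (by
      intro z hz
      obtain ⟨h1, h2, h3, h4⟩ := hz
      simp only [Set.mem_ofPred_eq]
      exact ⟨by linarith, by linarith, by linarith, by linarith⟩)
  have hend : w - t * y₀ + K / γ = L - w - t * h := by
    rw [hty₀, hA]
    ring
  have hw2 : (2 : ℝ) ≤ w := by exact_mod_cast hwN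
  have hwq : (w : ℝ) ≤ 3 * q ^ 2 := by rw [hw]; nlinarith
  have hty : ∀ y : ℝ, 0 ≤ y → 0 ≤ t * y := fun y hy => mul_nonneg ht0.le hy
  have hty' : ∀ y : ℝ, y ≤ h → t * y ≤ t * h := fun y hy => mul_le_mul_of_nonneg_left hy ht0.le
  have p6 := Packs.split (R := {z : ℝ × ℝ | 0 ≤ z.1 ∧ z.1 ≤ L ∧ 0 ≤ z.2 ∧ z.2 ≤ h ∧
      z.1 - t * z.2 ≤ L - w - t * h}) 1 (-t) (w - t * y₀) (Or.inl one_ne_zero) p3 p4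
    (fun z hz => by
      obtain ⟨h1, h2, h3, h4⟩ := hz
      have := hty' _ h3
      have := hty _ hy0
      exact ⟨h1, by linarith, h2, h3, by linarith⟩)
    (fun z hz => by
      obtain ⟨h1, h2, h3, h4⟩ := hz
      have := hty' _ h2
      have := hty _ h1
      exact ⟨by linarith, by linarith, h1, h2, by linarith⟩)
    (fun z hz => by linarith [hz.2.2.2]) (fun z hz => by linarith [hz.2.2.1])
  have p7 := Packs.split (R := Set.Icc 0 L ×ˢ Set.Icc 0 h) 1 (-t) (L - w - t * h)
    (Or.inl one_ne_zero) p6 p5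
    (fun z hz => ⟨⟨hz.1, hz.2.1⟩, ⟨hz.2.2.1, hz.2.2.2.1⟩⟩)
    (fun z hz => by
      obtain ⟨h1, h2, h3, h4⟩ := hz
      have := hty _ h2
      have := hty _ hh0
      exact ⟨⟨by linarith, h1⟩, ⟨h2, h3⟩⟩)
    (fun z hz => by linarith [hz.2.2.2.2]) (fun z hz => by linarith [hz.2.2.2])
  refine p7.mono le_rfl ?_
  -- The bars miss at most `2 * u ^ 2` of the height, over a length of at most `q ^ 5`.
  have hKN : (A + t * y₀) * h - 2 * q ^ 3 ≤ K * N := by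
    have e1 : (K : ℝ) * N = K / γ * (γ * N) := by field_simp
    have e2 : A + t * y₀ = K / γ := by rw [hty₀]; ring
    have h1 : h - 2 * u ^ 2 ≤ γ * N := by linarith
    have h2 := mul_le_mul_of_nonneg_left h1 (hA0.trans hK1')
    have h3 : K / γ * (2 * u ^ 2) ≤ q ^ 5 * (2 * u ^ 2) := by
      apply mul_le_mul_of_nonneg_right _ (by positivity)
      have := hty _ hh0
      linarith
    have e3 : (q : ℝ) ^ 5 * (2 * u ^ 2) = 2 * q ^ 3 := by
      linear_combination 2 * q ^ 3 * (q * u + 1) * hQu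
    rw [e1, e2]
    linarith
  have hQ3 : 1000 * (q : ℝ) ^ 2 ≤ q ^ 3 := by nlinarith [sq_nonneg (q : ℝ)]
  have hQ2 : 1000 * (q : ℝ) ≤ q ^ 2 := by nlinarith
  have hsq : 0 ≤ t * y₀ ^ 2 / 2 := by positivity
  push_cast
  rw [hA] at hKN
  linarith

/-! ### The whole square. -/

set_option maxHeartbeats 2000000 in
theorem wastedArea_le {x z : ℝ} (hz : 1000 ≤ z) (hx : x = z ^ 5) :
    wastedArea x ≤ 32000 * z ^ 3 := by
  set q := ⌈z⌉₊
  have hz0 : 0 < z := by linarith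
  have hzq : z ≤ q := Nat.le_ceil z
  have hqz : (q : ℝ) ≤ 2 * z := by
    have : (q : ℝ) < z + 1 := Nat.ceil_lt_add_one hz0.le
    linarith
  have hQ : (1000 : ℝ) ≤ q := hz.trans hzq
  have hq : 1000 ≤ q := by exact_mod_cast hQ
  have hP0 := period_pos q
  have hP1 := le_period q
  have hP2 := period_le hq
  have ht0 := sideSlope_pos q
  have htP := sideSlope_mul_period q
  have htu := sideSlope_le (q := q) (by omega)
  have hw := cast_baseWidth q
  have hQ2 : 1000 * (q : ℝ) ≤ q ^ 2 := by nlinarith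
  obtain ⟨γ, σ, ι, hγσ, hγ, hγ1, hσ, hσt, hσu, hιγ, hι, hι2, hι1⟩ :=
    exists_cos_sin_of_tan ht0.le
  set t := sideSlope q
  set P := period q
  have hu1 : (1 / q : ℝ) ^ 2 ≤ 1 / 2 := by
    have : (1 / q : ℝ) ≤ 1 / 1000 := one_div_le_one_div_of_le (by norm_num) hQ
    have := pow_le_pow_left₀ (by positivity) this 2
    linarith
  have ht1 : t ≤ 1 / 2 := by linarith
  have ht2 : t ^ 2 ≤ t := by nlinarith
  have hg1 : t ^ 2 / 4 ≤ 1 - γ := by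
    have := one_sub_cos_ge hιγ hι2 (by linarith)
    have e : t ^ 4 = t ^ 2 * t ^ 2 := by ring
    have : t ^ 2 * t ^ 2 ≤ t ^ 2 * (1 / 2) :=
      mul_le_mul_of_nonneg_left (by linarith) (sq_nonneg t)
    linarith
  have hg2 : 1 - γ ≤ t ^ 2 := by
    have : σ ^ 2 ≤ t ^ 2 := pow_le_pow_left₀ hσ hσu 2
    nlinarith
  have hg0 : 0 < 1 - γ := lt_of_lt_of_le (by positivity) hg1
  have hx0 : 0 ≤ x := by rw [hx]; positivity
  set f : ℝ := ⌈x⌉₊ - x with hf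
  have hf0 : 0 ≤ f := by linarith [Nat.le_ceil x]
  have hf1 : f ≤ 1 := by linarith [Nat.ceil_lt_add_one hx0]
  -- The least `N` for which leaning bars fit the height `N - 1 - f`; by minimality the slack is at
  -- most `1 - γ`. The summand `1` forces `N ≥ 1 / t ^ 2`, even if `f` is `0`, so that the strip is
  -- higher than a period.
  set N := ⌈(1 + f + σ) / (1 - γ)⌉₊
  have hN1 : 1 + f + σ ≤ N * (1 - γ) := by
    rw [← div_le_iff₀ hg0]
    exact Nat.le_ceil _
  have hN2 : N * (1 - γ) ≤ 1 + f + σ + (1 - γ) := by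
    have : (N : ℝ) < (1 + f + σ) / (1 - γ) + 1 := Nat.ceil_lt_add_one (by positivity)
    have h2 := mul_le_mul_of_nonneg_right this.le hg0.le
    rwa [add_mul, div_mul_cancel₀ _ hg0.ne', one_mul] at h2
  have hNu : (N : ℝ) ≤ 28 * q ^ 4 := by
    have h1 : (N - 1 : ℝ) * (t ^ 2 / 4) ≤ 3 := by
      by_cases hN : (0 : ℝ) ≤ N - 1
      · have := mul_le_mul_of_nonneg_left hg1 hN
        linarith
      · push Not at hN
        have : (N - 1 : ℝ) * (t ^ 2 / 4) ≤ 0 :=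
          mul_nonpos_of_nonpos_of_nonneg hN.le (by positivity)
        linarith
    have h2 : (N - 1 : ℝ) ≤ 3 * P ^ 2 := by
      have h3 := mul_le_mul_of_nonneg_right h1 (sq_nonneg P)
      have e : (N - 1 : ℝ) * (t ^ 2 / 4) * P ^ 2 = N - 1 := by
        linear_combination (N - 1 : ℝ) / 4 * (t * P + 2) * htP
      linarith
    have h3 : P ^ 2 ≤ (3 * q ^ 2 : ℝ) ^ 2 := pow_le_pow_left₀ hP0.le (by linarith) 2
    have h4 : (1 : ℝ) ≤ q ^ 4 := one_le_pow₀ (by linarith)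
    linarith
  have hNl : P + 2 ≤ N := by
    have h1 : 1 ≤ N * t ^ 2 := by
      have := mul_le_mul_of_nonneg_left hg2 (show (0 : ℝ) ≤ N from N.cast_nonneg)
      linarith
    have h2 := mul_le_mul_of_nonneg_right h1 (sq_nonneg P)
    have e : N * t ^ 2 * P ^ 2 = N * 4 := by
      linear_combination (N : ℝ) * (t * P + 2) * htP
    have := mul_le_mul_of_nonneg_right (show (2000 : ℝ) ≤ P by linarith) hP0.le
    linarith
  -- As `f` is `⌈x⌉₊ - x`, the difference `x - h` is an integer, the side of the square packed
  -- without waste.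
  set h : ℝ := N - 1 - f with hh
  have hhN : h ≤ 28 * q ^ 4 := by linarith
  have hq4 : (q : ℝ) ^ 4 ≤ 16 * z ^ 4 := by
    calc (q : ℝ) ^ 4 ≤ (2 * z) ^ 4 := pow_le_pow_left₀ (by linarith) hqz 4
      _ = _ := by ring
  have hq3 : (q : ℝ) ^ 3 ≤ 8 * z ^ 3 := by
    calc (q : ℝ) ^ 3 ≤ (2 * z) ^ 3 := pow_le_pow_left₀ (by linarith) hqz 3
      _ = _ := by ring
  have hxz : 1000 * z ^ 4 ≤ x := by
    have := mul_le_mul_of_nonneg_right hz (show 0 ≤ z ^ 4 by positivity)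
    rw [hx]
    linarith
  have hxh : 30 * (q : ℝ) ^ 4 ≤ x - h := by
    have : (0 : ℝ) ≤ z ^ 4 := by positivity
    linarith
  have hq42 : (q : ℝ) ^ 2 * 1000 ≤ q ^ 4 := by nlinarith [sq_nonneg (q : ℝ)]
  have hNx : N ≤ ⌈x⌉₊ + 1 := by
    have : (N : ℝ) ≤ ⌈x⌉₊ + 1 := by
      have : (0 : ℝ) ≤ q ^ 4 := by positivity
      linarith
    exact_mod_cast this
  obtain ⟨n, hn⟩ := Nat.exists_eq_add_of_le hNx
  have hn' : (n : ℝ) = x - h := by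
    have : ((⌈x⌉₊ + 1 : ℕ) : ℝ) = N + n := by rw [hn]; push_cast; ring
    push_cast at this
    linarith
  have hxq : x ≤ q ^ 5 := by rw [hx]; exact pow_le_pow_left₀ hz0.le hzq 5
  have hth : t * h ≤ 28 * q ^ 4 := by
    have : t * h ≤ 1 * h := mul_le_mul_of_nonneg_right (by linarith) (by linarith)
    linarith
  have hwn : 2 * (baseWidth q : ℝ) + t * h ≤ n := by
    rw [hn', hw]
    linarith
  have hn0 : (0 : ℝ) ≤ n := n.cast_nonneg
  have hstrip := fun L : ℝ => fun hL : L ≤ q ^ 5 => fun hL' : 2 * (baseWidth q : ℝ) + t * h ≤ L =>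
    packs_strip (N := N) (h := h) hq hγσ hγ hσt (by linarith) (by linarith) (by linarith) hhN hL hL'
  have p1 := (hstrip x hxq (by linarith)).translate
    (R' := Set.Icc 0 x ×ˢ Set.Icc (n : ℝ) x) (0, n) (by
      rintro z ⟨⟨h1, h2⟩, ⟨h3, h4⟩⟩
      exact ⟨⟨by simpa using h1, by simpa using h2⟩,
        ⟨by simpa using h3, by simp only; linarith⟩⟩)
  have p2 := ((hstrip n (by linarith) hwn).swap
    (R' := Set.Icc 0 h ×ˢ Set.Icc 0 (n : ℝ)) (fun z hz => ⟨hz.2, hz.1⟩)).translate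
    (R' := Set.Icc (n : ℝ) x ×ˢ Set.Icc 0 (n : ℝ)) (n, 0) (by
      rintro z ⟨⟨h1, h2⟩, ⟨h3, h4⟩⟩
      exact ⟨⟨by simpa using h1, by simp only; linarith⟩,
        ⟨by simpa using h3, by simpa using h4⟩⟩)
  have p3 := Packs.rectangle (R := Set.Icc 0 (n : ℝ) ×ˢ Set.Icc 0 (n : ℝ)) 0 0 n n
    (fun x y h1 h2 h3 h4 => ⟨⟨h1, by simpa using h2⟩, ⟨h3, by simpa using h4⟩⟩)
  have p4 := Packs.split (R := Set.Icc 0 x ×ˢ Set.Icc 0 (n : ℝ)) 1 0 n (Or.inl one_ne_zero) p3 p2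
    (fun z hz => ⟨⟨hz.1.1, by linarith [hz.1.2]⟩, hz.2⟩)
    (fun z hz => ⟨⟨by linarith [hz.1.1], hz.1.2⟩, hz.2⟩)
    (fun z hz => by linarith [hz.1.2]) (fun z hz => by linarith [hz.1.1])
  have p5 := Packs.split (R := bigSquare x) 0 1 n (Or.inr one_ne_zero) p4 p1
    (fun z hz => ⟨hz.1, ⟨hz.2.1, by linarith [hz.2.2]⟩⟩)
    (fun z hz => ⟨hz.1, ⟨by linarith [hz.2.1], hz.2.2⟩⟩)
    (fun z hz => by linarith [hz.2.2]) (fun z hz => by linarith [hz.2.1])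
  -- Two strips waste `2 * 2000 * q ^ 3`, and `q ^ 3 ≤ 8 * z ^ 3`; this is the constant `32000`.
  refine (wastedArea_le_of_packs hx0 p5).trans ?_
  have e : x = n + h := by linarith
  rw [e]
  linarith

theorem theorem1 :
    Asymptotics.IsBigO Filter.atTop wastedArea (fun x : ℝ => x ^ (3 / 5 : ℝ)) := by
  refine Asymptotics.IsBigO.of_bound 32000 ?_
  filter_upwards [Filter.eventually_ge_atTop ((1000 : ℝ) ^ 5)] with x hx
  have hx0 : 0 ≤ x := le_trans (by positivity) hx
  have hz : (1000 : ℝ) ≤ x ^ (1 / 5 : ℝ) := by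
    have := Real.rpow_le_rpow (by positivity) hx (show (0 : ℝ) ≤ 1 / 5 by norm_num)
    rw [← Real.rpow_natCast, ← Real.rpow_mul (by norm_num)] at this
    norm_num at this
    simpa using this
  have h5 : x = (x ^ (1 / 5 : ℝ)) ^ 5 := by
    rw [← Real.rpow_natCast, ← Real.rpow_mul hx0]
    norm_num
  have h3 : x ^ (3 / 5 : ℝ) = (x ^ (1 / 5 : ℝ)) ^ 3 := by
    rw [← Real.rpow_natCast, ← Real.rpow_mul hx0]
    norm_num
  rw [Real.norm_of_nonneg (wastedArea_nonneg x), Real.norm_of_nonneg (by positivity), h3]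
  exact wastedArea_le hz h5
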